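/- Let $L$ be Lebesgue measure on $\mathbb{C}$, let $\mathcal{E}=\{e^{-|z|^2/2}f(z):\ f\text{ entire}\}\cap L^2(\mathbb{C})$ be the Bargmann–Fock space, let $\Pi$ be the orthogonal projection of $L^2(\mathbb{C})$ onto $\mathcal{E}$, and let $L^{2,1}_{\mathcal{E}}=\{u=e^{-|z|^2/2}f(z):\ f\text{ entire},\ (1+|z|^2)^{1/2}u\in L^2(\mathbb{C})\}$. Consider the system $$ i\partial_t u=\Pi(|v|^2u),\qquad i\partial_t v=-\Pi(|u|^2v), \qquad (u,v)\in C^\infty(\mathbb{R},\mathcal{E}\times\mathcal{E}). \tag{S}$$ For $\lambda,\mu\in\mathbb{R}$, $\alpha\in\mathbb{C}$ and $U,V\in L^{2,1}_{\mathcal{E}}$, say that $(U,V)$ is (the initial datum of) a progressive wave with parameters $(\lambda,\mu,\alpha)$ if $$(u,v)(t,z)=\Big(e^{-i\lambda t}U(z+\alpha t)e^{\frac12(\bar z\alpha-z\bar\alpha)t},\ e^{-i\mu t}V(z+\alpha t)e^{\frac12(\bar z\alpha-z\bar\alpha)t}\Big)$$ is a solution of (S). Write $M(U)=\int_{\mathbb{C}}|U|^2dL$,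 $\mathcal{H}(U,V)=\int_{\mathbb{C}}|U|^2|V|^2dL$, $Q_-(U,V)=\int_{\mathbb{C}}z(|U|^2-|V|^2)\,dL$, $L_\theta U(z)=U(e^{i\theta}z)$, $R_\beta U(z)=U(z+\beta)e^{\frac12(\bar z\beta-z\bar\beta)}$, and $\partial_{\bar z}=\frac12(\partial_x+i\partial_y)$. **Proposition 1.8.** Let $(U,V)\neq(0,0)$, $U,V\in L^{2,1}_{\mathcal{E}}$, be a progressive wave with parameters $(\lambda,\mu,\alpha)$, where $\alpha\neq0$. Then: (i) $M(U)=M(V)$; (ii) $\operatorname{Re}(\bar\alpha Q_-(U,V))=0$; (iii) $\operatorname{Im}(\bar\alpha Q_-(U,V))\neq0$; (iv) for all $K\ge0$, $\theta,\theta_1,\theta_2\in\mathbb{R}$ and $\beta\in\mathbb{C}$, the following are also progressive waves, with components in $L^{2,1}_{\mathcal{E}}$ and with the indicated parameters: - $(Ke^{i\theta_1}U,\,Ke^{i\theta_2}V)$ with $(K^2\lambda,\,K^2\mu,\,K^2\alpha)$; - $(L_\theta U,\,L_\theta V)$ with $(\lambda,\,\mu,\,\alpha e^{-i\theta})$; -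 $(R_\beta U,\,R_\beta V)$ with $(\lambda+2\operatorname{Im}(\beta\bar\alpha),\,\mu+2\operatorname{Im}(\beta\bar\alpha),\,\alpha)$; - $(V,U)$ with $(-\mu,\,-\lambda,\,-\alpha)$; (v) $\displaystyle \alpha=\frac{i}{M(U)}\int_{\mathbb{C}}|V|^2\,\partial_{\bar z}(|U|^2)\,dL$; (vi) $\displaystyle |\alpha|\le\frac{M(U)}{2\sqrt2\,\pi}$; (vii) $(\lambda-\mu)M(U)-2i\bar\alpha Q_-(U,V)=2\mathcal{H}(U,V)$. -/

import Mathlib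

open MeasureTheory Complex Filter Topology
open scoped ContDiff ComplexConjugate

noncomputable section

namespace LLL

/-- `L²(ℂ)` for Lebesgue measure on `ℂ`. -/
abbrev L2C : Type := Lp ℂ 2 (volume : Measure ℂ)

/-- `u(z) = e^{-|z|²/2} f(z)` for every `z`, with `f` entire. -/
def IsGaussHolo (u : ℂ → ℂ) : Prop :=
  ∃ f : ℂ → ℂ, Differentiable ℂ f ∧ ∀ z, u z = (Real.exp (-‖z‖ ^ 2 / 2) : ℂ) * f z

/-- The Bargmann-Fock space `𝓔 = {e^{-|z|²/2} f(z), f entire} ∩ L²(ℂ)`, a subspace of `L²(ℂ)`. -/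
def fock : Submodule ℂ L2C where
  carrier := {u | ∃ w : ℂ → ℂ, IsGaussHolo w ∧ (u : ℂ → ℂ) =ᵐ[volume] w}
  zero_mem' := ⟨fun _ => 0, ⟨fun _ => 0, differentiable_const 0, by simp⟩, Lp.coeFn_zero _ _ _⟩
  add_mem' := by
    rintro a b ⟨w, ⟨f, hf, hw⟩, ha⟩ ⟨x, ⟨g, hg, hx⟩, hb⟩
    refine ⟨fun z => w z + x z, ⟨fun z => f z + g z, hf.add hg, fun z => ?_⟩, ?_⟩
    · change w z + x z = _
      rw [hw, hx]; ring
    · filter_upwards [Lp.coeFn_add a b, ha, hb] with z h1 h2 h3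
      rw [h1, Pi.add_apply, h2, h3]
  smul_mem' := by
    rintro c a ⟨w, ⟨f, hf, hw⟩, ha⟩
    refine ⟨fun z => c * w z, ⟨fun z => c * f z, hf.const_mul c, fun z => ?_⟩, ?_⟩
    · change c * w z = _
      rw [hw]; ring
    · filter_upwards [Lp.coeFn_smul c a, ha] with z h1 h2
      rw [h1, Pi.smul_apply, h2, smul_eq_mul]

/-! The space `𝓔` is closed in `L²(ℂ)`, so that the orthogonal projection on it exists. -/

lemma integral_ball_eq {g : ℂ → ℂ} (hg : Differentiable ℂ g) :
    ∫ z in Metric.ball (0 : ℂ) 1, g z = Real.pi * g 0 := by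
  rw [← integral_indicator Metric.isOpen_ball.measurableSet,
    ← Complex.integral_comp_polarCoord_symm, polarCoord_target]
  have key : ∀ p ∈ Set.Ioi (0 : ℝ) ×ˢ Set.Ioo (-Real.pi) Real.pi,
      p.1 • (Metric.ball (0 : ℂ) 1).indicator g (Complex.polarCoord.symm p) =
      (Set.Iio (1 : ℝ) ×ˢ (Set.univ : Set ℝ)).indicator
        (fun p : ℝ × ℝ => p.1 • g (circleMap 0 p.1 p.2)) p := by
    rintro ⟨r, θ⟩ ⟨hr, -⟩
    have hr : 0 < r := hr
    have h1 : Complex.polarCoord.symm (r, θ) = circleMap 0 r θ := by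
      simp [circleMap, Complex.exp_mul_I]
    have h2 : ‖circleMap 0 r θ‖ = r := by simp [abs_of_pos hr]
    by_cases h : r < 1
    · rw [Set.indicator_of_mem, Set.indicator_of_mem, h1]
      · exact ⟨h, trivial⟩
      · rw [h1, mem_ball_zero_iff, h2]; exact h
    · rw [Set.indicator_of_notMem, Set.indicator_of_notMem, smul_zero]
      · exact fun hh => h hh.1
      · rw [h1, mem_ball_zero_iff, h2]; exact h
  rw [setIntegral_congr_fun (measurableSet_Ioi.prod measurableSet_Ioo) key,
    setIntegral_indicator (measurableSet_Iio.prod MeasurableSet.univ), Set.prod_inter_prod,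
    Set.inter_univ, Set.Ioi_inter_Iio]
  have hc : Continuous fun p : ℝ × ℝ => p.1 • g (circleMap 0 p.1 p.2) := by
    have := hg.continuous
    unfold circleMap
    fun_prop
  rw [Measure.volume_eq_prod, setIntegral_prod]
  · have inner : ∀ r : ℝ, ∫ θ in Set.Ioo (-Real.pi) Real.pi, r • g (circleMap 0 r θ) =
        (r : ℂ) * (2 * Real.pi * g 0) := by
      intro r
      have hm : Real.circleAverage g 0 r = g 0 := DiffContOnCl.circleAverage hg.diffContOnCl
      rw [Real.circleAverage_eq_integral_add (-Real.pi)] at hm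
      have hpi : (Real.pi : ℂ) ≠ 0 := by exact_mod_cast Real.pi_ne_zero
      rw [← integral_Ioc_eq_integral_Ioo, ← intervalIntegral.integral_of_le (by
        linarith [Real.pi_pos]), intervalIntegral.integral_smul]
      have h3 : ∫ θ in (-Real.pi)..Real.pi, g (circleMap 0 r θ) = 2 * Real.pi * g 0 := by
        rw [← hm]
        rw [intervalIntegral.integral_comp_add_right (fun θ => g (circleMap 0 r θ))]
        rw [zero_add, Complex.real_smul]
        push_cast
        rw [show 2 * Real.pi + -Real.pi = Real.pi by ring]
        field_simp
      rw [h3, Complex.real_smul]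
    simp_rw [inner]
    rw [integral_mul_const, ← integral_Ioc_eq_integral_Ioo,
      ← intervalIntegral.integral_of_le zero_le_one, intervalIntegral.integral_ofReal]
    simp
    ring
  · exact (hc.continuousOn.integrableOn_compact
      (isCompact_Icc.prod isCompact_Icc)).mono_set
      (Set.prod_mono Set.Ioo_subset_Icc_self Set.Ioo_subset_Icc_self)

lemma norm_sq_le_integral_ball {f : ℂ → ℂ} (hf : Differentiable ℂ f) (z : ℂ) :
    Real.pi * ‖f z‖ ^ 2 ≤ ∫ w in Metric.ball z 1, ‖f w‖ ^ 2 := by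
  have hg : Differentiable ℂ (fun w => f (w + z) ^ 2) :=
    (hf.comp (differentiable_id.add_const z)).pow 2
  have h := integral_ball_eq hg
  have h2 := norm_integral_le_integral_norm (μ := volume.restrict (Metric.ball (0 : ℂ) 1))
    (fun w => f (w + z) ^ 2)
  rw [h] at h2
  simp only [zero_add, norm_mul, norm_pow, Complex.norm_real, Real.norm_eq_abs,
    abs_of_pos Real.pi_pos] at h2
  refine h2.trans (le_of_eq ?_)
  have := (measurePreserving_add_right (volume : Measure ℂ) z).setIntegral_preimage_emb
    (measurableEmbedding_addRight z) (fun w => ‖f w‖ ^ 2) (Metric.ball z 1)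
  rw [← this]
  congr 2
  ext w
  simp

lemma norm_sq_le {f : ℂ → ℂ} (hf : Differentiable ℂ f) {u : L2C}
    (hu : (u : ℂ → ℂ) =ᵐ[volume] fun z => (Real.exp (-‖z‖ ^ 2 / 2) : ℂ) * f z) (z : ℂ) :
    ‖f z‖ ^ 2 ≤ Real.exp ((‖z‖ + 1) ^ 2) * ‖u‖ ^ 2 := by
  have hint : Integrable (fun w => ‖(u : ℂ → ℂ) w‖ ^ 2) := by
    have := (Lp.memLp u).integrable_norm_rpow (by norm_num) (by norm_num)
    simpa using this
  have hnorm : ‖u‖ ^ 2 = ∫ w, ‖(u : ℂ → ℂ) w‖ ^ 2 := by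
    have h := L2.inner_def (𝕜 := ℂ) u u
    rw [inner_self_eq_norm_sq_to_K] at h
    simp_rw [inner_self_eq_norm_sq_to_K] at h
    have h' : ((‖u‖ ^ 2 : ℝ) : ℂ) = ((∫ w, ‖(u : ℂ → ℂ) w‖ ^ 2 : ℝ) : ℂ) := by
      rw [← integral_complex_ofReal]
      simpa using h
    exact_mod_cast h'
  have h1 := norm_sq_le_integral_ball hf z
  have h2 : ∫ w in Metric.ball z 1, ‖f w‖ ^ 2 ≤
      ∫ w in Metric.ball z 1, Real.exp ((‖z‖ + 1) ^ 2) * ‖(u : ℂ → ℂ) w‖ ^ 2 := by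
    refine integral_mono_ae ?_ (hint.const_mul _).integrableOn ?_
    · exact (((hf.continuous.norm.pow 2).continuousOn).integrableOn_compact
        (isCompact_closedBall z 1)).mono_set Metric.ball_subset_closedBall
    · filter_upwards [ae_restrict_of_ae hu, ae_restrict_mem Metric.isOpen_ball.measurableSet]
        with w hw hwb
      rw [hw, norm_mul, Complex.norm_real, Real.norm_eq_abs, Real.abs_exp, mul_pow,
        ← Real.exp_nat_mul, ← mul_assoc, ← Real.exp_add]
      refine le_mul_of_one_le_left (by positivity) (Real.one_le_exp ?_)
      have h3 : ‖w‖ ≤ ‖z‖ + 1 := by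
        have := norm_sub_norm_le w z
        rw [Metric.mem_ball, dist_eq_norm] at hwb
        linarith
      have h4 := norm_nonneg w
      push_cast
      nlinarith
  have h3 : ∫ w in Metric.ball z 1, Real.exp ((‖z‖ + 1) ^ 2) * ‖(u : ℂ → ℂ) w‖ ^ 2 ≤
      Real.exp ((‖z‖ + 1) ^ 2) * ‖u‖ ^ 2 := by
    rw [hnorm, ← integral_const_mul]
    exact setIntegral_le_integral (hint.const_mul _) (ae_of_all _ fun w => by positivity)
  have h4 : ‖f z‖ ^ 2 ≤ Real.pi * ‖f z‖ ^ 2 :=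
    le_mul_of_one_le_left (by positivity) (by linarith [Real.pi_gt_three])
  linarith

lemma isClosed_fock : IsClosed (fock : Set L2C) := by
  rw [← isSeqClosed_iff_isClosed]
  intro u u₀ hu hlim
  have hu' : ∀ n, ∃ f : ℂ → ℂ, Differentiable ℂ f ∧
      (u n : ℂ → ℂ) =ᵐ[volume] fun z => (Real.exp (-‖z‖ ^ 2 / 2) : ℂ) * f z := by
    intro n
    obtain ⟨w, ⟨f, hf, hw⟩, h⟩ := hu n
    exact ⟨f, hf, h.trans (ae_of_all _ hw)⟩
  choose f hf huf using hu'
  have hbound : ∀ n m z, ‖f n z - f m z‖ ^ 2 ≤ Real.exp ((‖z‖ + 1) ^ 2) * ‖u n - u m‖ ^ 2 := by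
    intro n m z
    refine norm_sq_le (f := fun z => f n z - f m z) ((hf n).sub (hf m)) ?_ z
    filter_upwards [Lp.coeFn_sub (u n) (u m), huf n, huf m] with w h1 h2 h3
    rw [h1, Pi.sub_apply, h2, h3]; ring
  have hcauchy : ∀ K : Set ℂ, IsCompact K → UniformCauchySeqOn f atTop K := by
    intro K hK
    obtain ⟨R, hR⟩ := hK.isBounded.subset_closedBall 0
    rw [Metric.uniformCauchySeqOn_iff]
    intro ε hε
    have hc := Metric.cauchySeq_iff.1 hlim.cauchySeq (ε / Real.exp ((|R| + 1) ^ 2)) (by positivity)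
    obtain ⟨N, hN⟩ := hc
    refine ⟨N, fun m hm n hn z hz => ?_⟩
    have h1 := hN m hm n hn
    have hz' : ‖z‖ ≤ |R| := (mem_closedBall_zero_iff.1 (hR hz)).trans (le_abs_self R)
    rw [dist_eq_norm] at h1 ⊢
    rw [lt_div_iff₀ (Real.exp_pos _)] at h1
    have h2 := hbound m n z
    have h3 : Real.exp ((‖z‖ + 1) ^ 2) ≤ Real.exp ((|R| + 1) ^ 2) ^ 2 := by
      rw [← Real.exp_nat_mul]
      apply Real.exp_le_exp.2
      have := norm_nonneg z
      push_cast
      nlinarith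
    have h4 : ‖f m z - f n z‖ ^ 2 ≤ (‖u m - u n‖ * Real.exp ((|R| + 1) ^ 2)) ^ 2 := by
      rw [mul_pow, mul_comm]
      exact h2.trans (mul_le_mul_of_nonneg_right h3 (by positivity))
    exact (le_of_sq_le_sq h4 (by positivity)).trans_lt h1
  have hpt : ∀ z, ∃ l, Tendsto (fun n => f n z) atTop (𝓝 l) := fun z =>
    cauchySeq_tendsto_of_complete ((hcauchy {z} isCompact_singleton).cauchySeq rfl)
  choose F hF using hpt
  have hloc : TendstoLocallyUniformlyOn f F atTop Set.univ := by
    rw [tendstoLocallyUniformlyOn_iff_forall_isCompact isOpen_univ]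
    exact fun K _ hK => (hcauchy K hK).tendstoUniformlyOn_of_tendsto fun z _ => hF z
  have hFd : Differentiable ℂ F := differentiableOn_univ.1
    (hloc.differentiableOn (Eventually.of_forall fun n => (hf n).differentiableOn) isOpen_univ)
  refine ⟨fun z => (Real.exp (-‖z‖ ^ 2 / 2) : ℂ) * F z, ⟨F, hFd, fun z => rfl⟩, ?_⟩
  obtain ⟨ns, hns, hae⟩ := (tendstoInMeasure_of_tendsto_Lp hlim).exists_seq_tendsto_ae
  filter_upwards [hae, ae_all_iff.2 huf] with z h1 h2
  refine tendsto_nhds_unique h1 ?_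
  simp_rw [h2]
  exact ((hF z).comp hns.tendsto_atTop).const_mul _

instance : CompleteSpace fock := isClosed_fock.completeSpace_coe

/-- `Π`, the orthogonal projection of `L²(ℂ)` on `𝓔`. -/
def proj : L2C →L[ℂ] fock := fock.orthogonalProjectionOnto

/-- Solutions `(u, v) ∈ C^∞(ℝ, 𝓔 × 𝓔)` of `i ∂ₜ u = Π(|v|² u)`, `i ∂ₜ v = σ Π(|u|² v)`.
The cubic terms are elements of `L²(ℂ)`, and the time derivatives are taken in `𝓔`. -/
structure IsSolution (σ : ℝ) (u v : ℝ → fock) : Prop where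
  smooth_fst : ContDiff ℝ ∞ u
  smooth_snd : ContDiff ℝ ∞ v
  eq_fst : ∀ t : ℝ, ∃ h : MemLp (fun z : ℂ => (‖(v t : L2C) z‖ ^ 2 : ℂ) * (u t : L2C) z) 2 volume,
    I • deriv u t = proj h.toLp
  eq_snd : ∀ t : ℝ, ∃ h : MemLp (fun z : ℂ => (‖(u t : L2C) z‖ ^ 2 : ℂ) * (v t : L2C) z) 2 volume,
    I • deriv v t = (σ : ℂ) • proj h.toLp

/-- The space rotation `L_θ U (z) = U(e^{iθ} z)`. -/
def rot (θ : ℝ) (U : ℂ → ℂ) (z : ℂ) : ℂ := U (exp (I * θ) * z)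

/-- The magnetic translation `R_β U (z) = U(z + β) e^{(z̄ β - z β̄)/2}`. -/
def magTrans (β : ℂ) (U : ℂ → ℂ) (z : ℂ) : ℂ :=
  U (z + β) * exp ((1 / 2) * (conj z * β - z * conj β))

/-- `(t, z) ↦ e^{-iλt} U(z + αt) e^{(z̄ α - z ᾱ)t/2}`. -/
def wave (lam : ℝ) (α : ℂ) (U : ℂ → ℂ) (t : ℝ) (z : ℂ) : ℂ :=
  exp (-I * lam * t) * U (z + α * t) * exp ((1 / 2) * (conj z * α - z * conj α) * t)

/-- `L^{2,1}_𝓔`: functions `e^{-|z|²/2} f(z)`, `f` entire, with `⟨z⟩ u ∈ L²(ℂ)`. Its elements are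
taken as genuine (smooth) functions. -/
def MemL21 (U : ℂ → ℂ) : Prop :=
  IsGaussHolo U ∧ MemLp (fun z : ℂ => (Real.sqrt (1 + ‖z‖ ^ 2) : ℂ) * U z) 2 volume

/-- `U, V ∈ L^{2,1}_𝓔`, and
`(e^{-iλt} U(z + αt) e^{(z̄ α - z ᾱ)t/2}, e^{-iμt} V(z + αt) e^{(z̄ α - z ᾱ)t/2})`
solves the system with sign `σ`. -/
structure IsProgressiveWave (σ lam mu : ℝ) (α : ℂ) (U V : ℂ → ℂ) : Prop where
  mem_fst : MemL21 U
  mem_snd : MemL21 V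
  solves : ∃ u v : ℝ → fock, IsSolution σ u v ∧
    ∀ t : ℝ, ((u t : L2C) : ℂ → ℂ) =ᵐ[volume] wave lam α U t ∧
      ((v t : L2C) : ℂ → ℂ) =ᵐ[volume] wave mu α V t

/-- The mass. -/
def mass (U : ℂ → ℂ) : ℝ := ∫ z : ℂ, ‖U z‖ ^ 2

/-- The Hamiltonian. -/
def ham (U V : ℂ → ℂ) : ℝ := ∫ z : ℂ, ‖U z‖ ^ 2 * ‖V z‖ ^ 2

/-- The magnetic momentum `Q_-`. -/
def Qminus (U V : ℂ → ℂ) : ℂ := ∫ z : ℂ, z * ((‖U z‖ ^ 2 - ‖V z‖ ^ 2 : ℝ) : ℂ)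

/-- `∂_{z̄} = (∂_x + i ∂_y)/2`. -/
def dbar (g : ℂ → ℂ) (z : ℂ) : ℂ := (1 / 2) * (fderiv ℝ g z 1 + I * fderiv ℝ g z I)

/-- `F(U, V) = (i / M(U)) ∫ |V|² ∂_{z̄}(|U|²) dL`. -/
def speed (U V : ℂ → ℂ) : ℂ :=
  I / (mass U : ℂ) * ∫ z : ℂ, (‖V z‖ ^ 2 : ℂ) * dbar (fun w => (‖U w‖ ^ 2 : ℂ)) z

end LLL

end

noncomputable section

namespace LLL

/-! ### The operator `∂_{z̄}` -/

/-! Put y = Im(ᾱz). Differentiating the wave at t = 0 gives a stationary equation: U is killed by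
the Toeplitz operator u ↦ Π(φu) with symbol φ = 2y + λ - |V|², and V by the one with symbol 2y + μ +
|U|² (`isProfile_of_solves`). The term 2y appears because f ↦ f' and multiplication by z are adjoint
on Fock space. Apart from the symmetries (iv), everything follows by pairing this equation with
well-chosen K ∈ 𝓔.

K = U gives an energy identity (`IsProfile.energy`); the difference of the two is (vii), once (ii)
is known. Combining K = e^{-|z|²/2} f' with K = zU produces ∂_z̄|U|², and integration by parts gives
∫|V|² ∂_z̄|U|² = -iαM(U), which is (v), with the opposite sign for V (`IsProfile.speed_identity`).
The sum of the two is the integral of ∂_z̄(|U|²|V|²), hence zero, and α ≠ 0 gives (i).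

For (iii), suppose the y-moments of |U|² and |V|² are both Y. The quartic terms cancel in the sum of
the energy identities and in the sum of the identities tested with zU and zV; what is left says that
the total variance of y about Y/M is zero. Then U lives on a line, so U = 0
(`momIm_ne_of_isProfile`).

For (ii), the natural test function is the angular derivative of U, which is not known to lie in 𝓔.
Testing with L_θ U and L_{-θ} U and subtracting replaces it: the odd part in θ is 4 sin θ
∫Re(ᾱz)|U|² plus a quartic term, up to o(θ) (`IsProfile.rot_estimate`). The quartic terms for U and
V coincide, so the Re-moments agree (`momRe_eq_of_isProfile`).

For (vi), the difference of the speed identities writes 2αM as the integral of a Wronskian. That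
Wronskian is a derivative at w = 0 of (f(z+w)g(z-w))², which Cauchy's formula controls by
∫|U(z+w)|²|V(z-w)|² dw; integrating in z gives M²/4 (`wronskian_pointwise`,
`norm_integral_wronskian_le`).

For (iv), rotations and magnetic translations are unitary, preserve 𝓔 together with their inverses,
and so commute with Π (`FockTwist.proj_toLp`); scaling and swap are changes of time. -/

lemma dbar_mul {F G : ℂ → ℂ} {z : ℂ} (hF : DifferentiableAt ℝ F z)
    (hG : DifferentiableAt ℝ G z) :
    dbar (fun w => F w * G w) z = dbar F z * G z + F z * dbar G z := by
  unfold dbar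
  rw [show (fun w => F w * G w) = F * G from rfl, fderiv_mul hF hG]
  simp only [_root_.add_apply, _root_.smul_apply, smul_eq_mul]
  ring

lemma dbar_of_differentiableAt {a : ℂ → ℂ} {z : ℂ} (ha : DifferentiableAt ℂ a z) :
    dbar a z = 0 := by
  have h := (ha.hasFDerivAt.restrictScalars ℝ).fderiv
  unfold dbar
  rw [h]
  have : (fderiv ℂ a z) I = I * (fderiv ℂ a z) 1 := by
    rw [← smul_eq_mul, ← map_smul, smul_eq_mul, mul_one]
  simp only [ContinuousLinearMap.coe_restrictScalars', this, ← mul_assoc, I_mul_I]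
  ring

lemma dbar_conj_of_differentiableAt {b : ℂ → ℂ} {z : ℂ} (hb : DifferentiableAt ℂ b z) :
    dbar (fun w => conj (b w)) z = conj (deriv b z) := by
  have h1 := (hb.hasFDerivAt.restrictScalars ℝ)
  have h := ((conjCLE : ℂ →L[ℝ] ℂ).hasFDerivAt.comp z h1).fderiv
  have h' : fderiv ℝ (fun w => conj (b w)) z =
      (conjCLE : ℂ →L[ℝ] ℂ).comp ((fderiv ℂ b z).restrictScalars ℝ) := h
  unfold dbar
  rw [h']
  have : (fderiv ℂ b z) I = I * (fderiv ℂ b z) 1 := by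
    rw [← smul_eq_mul, ← map_smul, smul_eq_mul, mul_one]
  simp only [ContinuousLinearMap.comp_apply, ContinuousLinearMap.coe_restrictScalars', this,
    ContinuousLinearEquiv.coe_coe, conjCLE_apply, map_mul, conj_I, fderiv_eq_smul_deriv, one_smul]
  linear_combination (-(1 / 2) * conj (deriv b z)) * I_mul_I

lemma dbar_cexp {h : ℂ → ℂ} {z : ℂ} (hh : DifferentiableAt ℝ h z) :
    dbar (fun w => exp (h w)) z = exp (h z) * dbar h z := by
  have h1 := hh.hasFDerivAt.cexp.fderiv
  unfold dbar
  rw [h1]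
  simp only [_root_.smul_apply, smul_eq_mul]
  ring

/-- The Gaussian multiple `e^{-|z|²/2} f(z)`. -/
def gaussMul (f : ℂ → ℂ) (z : ℂ) : ℂ := (Real.exp (-‖z‖ ^ 2 / 2) : ℂ) * f z

lemma differentiable_conj_comp {b : ℂ → ℂ} (hb : Differentiable ℂ b) :
    Differentiable ℝ (fun w => conj (b w)) :=
  (conjCLE : ℂ →L[ℝ] ℂ).differentiable.comp (hb.restrictScalars ℝ)

lemma gaussMul_mul_conj_gaussMul (a b : ℂ → ℂ) (z : ℂ) :
    gaussMul a z * conj (gaussMul b z) = exp (-(z * conj z)) * (a z * conj (b z)) := by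
  have : exp (-(z * conj z)) =
      (Real.exp (-‖z‖ ^ 2 / 2) : ℂ) * (Real.exp (-‖z‖ ^ 2 / 2) : ℂ) := by
    rw [← ofReal_mul, ← Real.exp_add, mul_conj, normSq_eq_norm_sq, ofReal_exp]
    push_cast
    ring_nf
  rw [this]
  simp only [gaussMul, map_mul, conj_ofReal]
  ring

lemma continuous_gaussMul {f : ℂ → ℂ} (hf : Differentiable ℂ f) : Continuous (gaussMul f) := by
  have := hf.continuous
  unfold gaussMul
  fun_prop

lemma contDiff_gaussMul {f : ℂ → ℂ} (hf : Differentiable ℂ f) : ContDiff ℝ 1 (gaussMul f) := by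
  have h1 : ContDiff ℝ 1 f := (hf.contDiff (n := 1)).restrict_scalars ℝ
  have h2 : ContDiff ℝ 1 fun z : ℂ => ‖z‖ ^ 2 := contDiff_norm_sq ℝ
  have h3 : ContDiff ℝ 1 fun z : ℂ => Real.exp (-‖z‖ ^ 2 / 2) :=
    Real.contDiff_exp.comp (h2.neg.div_const 2)
  exact (ofRealCLM.contDiff.comp h3).mul h1

lemma contDiff_gaussMul_mul_conj {a b : ℂ → ℂ} (ha : Differentiable ℂ a)
    (hb : Differentiable ℂ b) :
    ContDiff ℝ 1 fun w => gaussMul a w * conj (gaussMul b w) :=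
  (contDiff_gaussMul ha).mul ((conjCLE : ℂ →L[ℝ] ℂ).contDiff.comp (contDiff_gaussMul hb))

/-- The product is e^{-z z̄} a conj(b): `a` is invisible to ∂_z̄, conj(b) contributes the conjugate
of b', and the Gaussian contributes -z. -/
lemma dbar_gaussMul_mul_conj {a b : ℂ → ℂ} (ha : Differentiable ℂ a) (hb : Differentiable ℂ b)
    (z : ℂ) :
    dbar (fun w => gaussMul a w * conj (gaussMul b w)) z =
      gaussMul a z * conj (gaussMul (deriv b) z) - z * (gaussMul a z * conj (gaussMul b z)) := by
  simp_rw [gaussMul_mul_conj_gaussMul]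
  have hid : DifferentiableAt ℝ (fun w : ℂ => conj w) z :=
    differentiable_conj_comp (b := fun w => w) differentiable_id z
  have hzz : DifferentiableAt ℝ (fun w : ℂ => w * conj w) z := differentiableAt_id.mul hid
  have ha' : DifferentiableAt ℝ a z := ha.restrictScalars ℝ z
  have hb' := differentiable_conj_comp hb z
  have hneg : dbar (fun w => -(w * conj w)) z = -z := by
    have h1 : (fun w : ℂ => -(w * conj w)) = fun w => (-w) * conj w := by
      funext w; ring
    have h2 : DifferentiableAt ℂ (fun w : ℂ => -w) z := differentiableAt_id.neg
    rw [h1, dbar_mul (h2.restrictScalars ℝ) hid, dbar_of_differentiableAt h2,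
      dbar_conj_of_differentiableAt (b := fun w => w) differentiableAt_id, deriv_id'']
    simp
  have hzn : DifferentiableAt ℝ (fun w : ℂ => -(w * conj w)) z := hzz.neg
  have hab : DifferentiableAt ℝ (fun w : ℂ => a w * conj (b w)) z := ha'.mul hb'
  rw [dbar_mul hzn.cexp hab, dbar_cexp hzn, hneg, dbar_mul ha' hb',
    dbar_of_differentiableAt (ha z), dbar_conj_of_differentiableAt (hb z)]
  ring

lemma continuous_dbar {W : ℂ → ℂ} (hW : ContDiff ℝ 1 W) : Continuous (dbar W) := by
  have h := hW.continuous_fderiv one_ne_zero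
  unfold dbar
  fun_prop

/-! ### Integration by parts for ∂_z̄ on the whole plane. -/

lemma integral_mul_dbar_of_hasCompactSupport {χ W : ℂ → ℂ} (hχ : ContDiff ℝ 1 χ)
    (hs : HasCompactSupport χ) (hW : ContDiff ℝ 1 W) :
    ∫ z, χ z * dbar W z = -∫ z, dbar χ z * W z := by
  have hdW := hW.continuous_fderiv one_ne_zero
  have hdχ := hχ.continuous_fderiv one_ne_zero
  have i1 : ∀ v : ℂ, Integrable fun z => χ z * fderiv ℝ W z v := fun v =>
    (hχ.continuous.mul (hdW.clm_apply continuous_const)).integrable_of_hasCompactSupport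
      hs.mul_right
  have i2 : ∀ v : ℂ, Integrable fun z => fderiv ℝ χ z v * W z := fun v =>
    ((hdχ.clm_apply continuous_const).mul hW.continuous).integrable_of_hasCompactSupport
      (hs.fderiv_apply ℝ v).mul_right
  have i3 : Integrable fun z => χ z * W z :=
    (hχ.continuous.mul hW.continuous).integrable_of_hasCompactSupport hs.mul_right
  have key : ∀ v : ℂ, ∫ z, χ z * fderiv ℝ W z v = -∫ z, fderiv ℝ χ z v * W z := fun v =>
    integral_mul_fderiv_eq_neg_fderiv_mul_of_integrable (i2 v) (i1 v) i3
      (fun x _ => hχ.differentiable one_ne_zero x) (fun x _ => hW.differentiable one_ne_zero x)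
  have e1 : (fun z => χ z * dbar W z) = fun z =>
      (1 / 2 : ℂ) * (χ z * fderiv ℝ W z 1) + (I / 2) * (χ z * fderiv ℝ W z I) := by
    funext z; unfold dbar; ring
  have e2 : (fun z => dbar χ z * W z) = fun z =>
      (1 / 2 : ℂ) * (fderiv ℝ χ z 1 * W z) + (I / 2) * (fderiv ℝ χ z I * W z) := by
    funext z; unfold dbar; ring
  rw [e1, e2, integral_add ((i1 1).const_mul _) ((i1 I).const_mul _),
    integral_add ((i2 1).const_mul _) ((i2 I).const_mul _)]
  simp only [integral_const_mul, key]
  ring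

lemma norm_dbar_le (W : ℂ → ℂ) (z : ℂ) : ‖dbar W z‖ ≤ ‖fderiv ℝ W z‖ := by
  have h1 : ‖fderiv ℝ W z 1‖ ≤ ‖fderiv ℝ W z‖ := by
    simpa using (fderiv ℝ W z).le_opNorm 1
  have h2 : ‖fderiv ℝ W z I‖ ≤ ‖fderiv ℝ W z‖ := by
    simpa using (fderiv ℝ W z).le_opNorm I
  have h3 := norm_add_le (fderiv ℝ W z 1) (I * fderiv ℝ W z I)
  rw [norm_mul, norm_I, one_mul] at h3
  unfold dbar
  rw [norm_mul]
  norm_num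
  linarith

lemma exists_cutoff : ∃ (χ : ℕ → ℂ → ℂ) (C : ℝ), (∀ n, ContDiff ℝ 1 (χ n)) ∧
    (∀ n, HasCompactSupport (χ n)) ∧ (∀ n z, ‖χ n z‖ ≤ 1) ∧
    (∀ z, Tendsto (fun n => χ n z) atTop (𝓝 1)) ∧
    ∀ n z, ‖dbar (χ n) z‖ ≤ C / (n + 1) := by
  let b : ContDiffBump (0 : ℂ) := ⟨1, 2, one_pos, one_lt_two⟩
  let φ : ℂ → ℂ := fun z => (b z : ℂ)
  have hφ : ContDiff ℝ 1 φ := ofRealCLM.contDiff.comp b.contDiff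
  have hs : HasCompactSupport φ := b.hasCompactSupport.comp_left ofReal_zero
  obtain ⟨C, hC⟩ := (hs.fderiv ℝ).exists_bound_of_continuous (hφ.continuous_fderiv one_ne_zero)
  have hn : ∀ n : ℕ, ((n : ℝ) + 1)⁻¹ ≠ 0 := fun n => by positivity
  refine ⟨fun n z => φ (((n : ℝ) + 1)⁻¹ • z), C, fun n => ?_, fun n => ?_, fun n z => ?_,
    fun z => ?_, fun n z => ?_⟩
  · exact hφ.comp (contDiff_const_smul _)
  · exact hs.comp_smul (hn n)
  · simp only [φ, norm_real, Real.norm_eq_abs, abs_of_nonneg b.nonneg]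
    exact b.le_one
  · have h0 : Tendsto (fun n : ℕ => ((n : ℝ) + 1)⁻¹ • z) atTop (𝓝 ((0 : ℝ) • z)) := by
      refine Tendsto.smul_const ?_ z
      simpa [one_div] using tendsto_one_div_add_atTop_nhds_zero_nat (𝕜 := ℝ)
    have h1 : φ ((0 : ℝ) • z) = 1 := by
      simp only [φ, zero_smul]
      rw [b.one_of_mem_closedBall (by simp [b])]
      simp
    rw [← h1]
    exact (hφ.continuous.tendsto _).comp h0
  · refine (norm_dbar_le _ z).trans ?_
    rw [fderiv_comp_smul, norm_smul, Real.norm_of_nonneg (by positivity), div_eq_inv_mul]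
    exact mul_le_mul_of_nonneg_left (hC _) (by positivity)

/-- Only the combination ∂_z̄W is assumed integrable, not the individual partial derivatives, so the
usual theorem does not apply directly. Cutoffs whose ∂_z̄ is O(1/n) bridge the gap. -/
lemma integral_dbar_eq_zero {W : ℂ → ℂ} (hW : ContDiff ℝ 1 W) (h1 : Integrable W)
    (h2 : Integrable (dbar W)) : ∫ z, dbar W z = 0 := by
  obtain ⟨χ, C, hχ, hs, hle, hlim, hd⟩ := exists_cutoff
  have l1 : Tendsto (fun n => ∫ z, χ n z * dbar W z) atTop (𝓝 (∫ z, dbar W z)) := by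
    refine tendsto_integral_of_dominated_convergence (fun z => ‖dbar W z‖)
      (fun n => ((hχ n).continuous.mul (continuous_dbar hW)).aestronglyMeasurable) h2.norm
      (fun n => ae_of_all _ fun z => ?_) (ae_of_all _ fun z => ?_)
    · rw [norm_mul]
      exact mul_le_of_le_one_left (norm_nonneg _) (hle n z)
    · simpa using (hlim z).mul_const (dbar W z)
  have l2 : Tendsto (fun n => ∫ z, χ n z * dbar W z) atTop (𝓝 0) := by
    have hb : ∀ n : ℕ, ‖∫ z, χ n z * dbar W z‖ ≤ C / (n + 1) * ∫ z, ‖W z‖ := by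
      intro n
      rw [integral_mul_dbar_of_hasCompactSupport (hχ n) (hs n) hW, norm_neg,
        ← integral_const_mul]
      refine norm_integral_le_of_norm_le (h1.norm.const_mul _) (ae_of_all _ fun z => ?_)
      rw [norm_mul]
      exact mul_le_mul_of_nonneg_right (hd n z) (norm_nonneg _)
    have h0 : Tendsto (fun n : ℕ => C / ((n : ℝ) + 1) * ∫ z, ‖W z‖) atTop (𝓝 0) := by
      have := (tendsto_one_div_add_atTop_nhds_zero_nat (𝕜 := ℝ)).const_mul (C)
      simpa [div_eq_mul_inv] using this.mul_const (∫ z, ‖W z‖)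
    exact squeeze_zero_norm hb h0
  exact tendsto_nhds_unique l1 l2

/-! ### The equation satisfied by the profile of a progressive wave -/

lemma integrable_mul_conj {a b : ℂ → ℂ} (ha : MemLp a 2 (volume : Measure ℂ))
    (hb : MemLp b 2 (volume : Measure ℂ)) : Integrable fun z => a z * conj (b z) :=
  MemLp.integrable_mul ha hb.star

/-- Adjointness of creation and annihilation: the difference of the two integrands is an exact ∂_z̄
derivative. -/
lemma integral_gaussMul_mul_conj_deriv {a b : ℂ → ℂ} (ha : Differentiable ℂ a)
    (hb : Differentiable ℂ b)
    (h1 : Integrable fun z => gaussMul a z * conj (gaussMul b z))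
    (h2 : Integrable fun z => gaussMul a z * conj (gaussMul (deriv b) z))
    (h3 : Integrable fun z => z * (gaussMul a z * conj (gaussMul b z))) :
    ∫ z, gaussMul a z * conj (gaussMul (deriv b) z) =
      ∫ z, z * (gaussMul a z * conj (gaussMul b z)) := by
  have h := integral_dbar_eq_zero (contDiff_gaussMul_mul_conj ha hb) h1
    (by rw [funext (dbar_gaussMul_mul_conj ha hb)]; exact h2.sub h3)
  simp_rw [dbar_gaussMul_mul_conj ha hb] at h
  rw [integral_sub h2 h3] at h
  exact sub_eq_zero.1 h

/-- The magnetic phase cancels the z̄-dependence created by translating the Gaussian. In the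
resulting form t enters holomorphically, so it may be differentiated as a complex variable. -/
lemma wave_gaussMul (lam : ℝ) (α : ℂ) (f : ℂ → ℂ) (t : ℝ) (z : ℂ) :
    wave lam α (gaussMul f) t z = (Real.exp (-‖z‖ ^ 2 / 2) : ℂ) *
      (exp (-I * lam * t - α * conj α * t ^ 2 / 2 - z * conj α * t) * f (z + α * t)) := by
  have e : ∀ w : ℂ, (Real.exp (-‖w‖ ^ 2 / 2) : ℂ) = exp (-(w * conj w) / 2) := by
    intro w
    rw [mul_conj, normSq_eq_norm_sq, ofReal_exp]
    push_cast
    ring_nf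
  have h : exp (-I * lam * t) * exp (-((z + α * t) * conj (z + α * t)) / 2) *
      exp ((1 / 2) * (conj z * α - z * conj α) * t) = exp (-(z * conj z) / 2) *
      exp (-I * lam * t - α * conj α * t ^ 2 / 2 - z * conj α * t) := by
    simp only [← Complex.exp_add, map_add, map_mul, conj_ofReal]
    ring_nf
  unfold wave gaussMul
  rw [e, e, ← mul_assoc (exp (-(z * conj z) / 2)), ← h]
  ring

lemma hasDerivAt_wave_gaussMul (lam : ℝ) (α : ℂ) {f : ℂ → ℂ} (hf : Differentiable ℂ f) (z : ℂ) :
    HasDerivAt (fun t : ℝ => wave lam α (gaussMul f) t z)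
      (-I * lam * gaussMul f z + α * gaussMul (deriv f) z - conj α * (z * gaussMul f z)) 0 := by
  simp_rw [wave_gaussMul]
  have hl : ∀ c : ℂ, HasDerivAt (fun s : ℂ => c * s) c 0 := fun c => by
    simpa using (hasDerivAt_id (0 : ℂ)).const_mul c
  have h1 : HasDerivAt (fun s : ℂ => -I * lam * s - α * conj α * s ^ 2 / 2 - z * conj α * s)
      (-I * lam - z * conj α) 0 := by
    have hq : HasDerivAt (fun s : ℂ => α * conj α * s ^ 2 / 2) 0 0 := by
      simpa using (((hasDerivAt_id (0 : ℂ)).pow 2).const_mul (α * conj α)).div_const 2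
    simpa using ((hl (-I * lam)).fun_sub hq).fun_sub (hl (z * conj α))
  have h2 : HasDerivAt (fun s : ℂ => f (z + α * s)) (deriv f z * α) 0 := by
    have h3 : HasDerivAt f (deriv f z) (z + α * 0) := by
      simpa using (hf z).hasDerivAt
    exact h3.comp (0 : ℂ) ((hl α).const_add z)
  have h := ((h1.cexp.fun_mul h2).const_mul (Real.exp (-‖z‖ ^ 2 / 2) : ℂ))
  rw [← ofReal_zero] at h
  have h' := h.comp_ofReal
  refine h'.congr_deriv ?_
  simp [gaussMul]
  ring

/-- The difference quotients at times 1/(n+1) converge in L², hence almost everywhere along a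
subsequence, where the limit must be the pointwise derivative. -/
lemma deriv_ae_eq {u : ℝ → fock} {w : ℝ → ℂ → ℂ} {w' : ℂ → ℂ} (hu : DifferentiableAt ℝ u 0)
    (hw : ∀ t, ((u t : L2C) : ℂ → ℂ) =ᵐ[volume] w t)
    (hd : ∀ z, HasDerivAt (fun t => w t z) (w' z) 0) :
    ((deriv u 0 : fock) : L2C) =ᵐ[volume] w' := by
  have hs0 : Tendsto (fun n : ℕ => ((n : ℝ) + 1)⁻¹) atTop (𝓝[≠] 0) := by
    refine tendsto_nhdsWithin_iff.2 ⟨?_, Eventually.of_forall fun n => ?_⟩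
    · simpa [one_div] using tendsto_one_div_add_atTop_nhds_zero_nat (𝕜 := ℝ)
    · exact inv_ne_zero (by positivity)
  have h1 : Tendsto (fun n : ℕ => (((((n : ℝ) + 1)⁻¹)⁻¹ • (u (((n : ℝ) + 1)⁻¹) - u 0) : fock) : L2C))
      atTop (𝓝 ((deriv u 0 : fock) : L2C)) := by
    have := (hasDerivAt_iff_tendsto_slope_zero.1 hu.hasDerivAt).comp hs0
    simp only [Function.comp_def, zero_add] at this
    exact (continuous_subtype_val.tendsto _).comp this
  obtain ⟨ns, hns, hae⟩ := (tendstoInMeasure_of_tendsto_Lp h1).exists_seq_tendsto_ae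
  have hq : ∀ n : ℕ, ((((((n : ℝ) + 1)⁻¹)⁻¹ • (u (((n : ℝ) + 1)⁻¹) - u 0) : fock) : L2C) : ℂ → ℂ)
      =ᵐ[volume] fun z => (((n : ℝ) + 1)⁻¹)⁻¹ • (w (((n : ℝ) + 1)⁻¹) z - w 0 z) := by
    intro n
    have e : (((((n : ℝ) + 1)⁻¹)⁻¹ • (u (((n : ℝ) + 1)⁻¹) - u 0) : fock) : L2C) =
        (((n : ℝ) + 1)⁻¹)⁻¹ • ((u (((n : ℝ) + 1)⁻¹) : L2C) - (u 0 : L2C)) := rfl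
    rw [e]
    filter_upwards [Lp.coeFn_smul (((n : ℝ) + 1)⁻¹)⁻¹ ((u (((n : ℝ) + 1)⁻¹) : L2C) - (u 0 : L2C)),
      Lp.coeFn_sub (u (((n : ℝ) + 1)⁻¹) : L2C) (u 0 : L2C), hw (((n : ℝ) + 1)⁻¹), hw 0]
      with z a1 a2 a3 a4
    rw [a1, Pi.smul_apply, a2, Pi.sub_apply, a3, a4]
  filter_upwards [hae, ae_all_iff.2 hq] with z h2 h3
  refine tendsto_nhds_unique h2 ?_
  simp_rw [h3]
  have := ((hasDerivAt_iff_tendsto_slope_zero.1 (hd z)).comp hs0).comp hns.tendsto_atTop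
  simpa only [Function.comp_def, zero_add] using this

lemma integral_linearCombination (a b c : ℂ) {F G H : ℂ → ℂ} (hF : Integrable F)
    (hG : Integrable G) (hH : Integrable H) :
    ∫ z, (a * F z + b * G z - c * H z) =
      a * (∫ z, F z) + b * (∫ z, G z) - c * ∫ z, H z := by
  have h1 : Integrable fun z => a * F z + b * G z := (hF.const_mul a).add (hG.const_mul b)
  rw [integral_sub h1 (hH.const_mul c), integral_add (hF.const_mul a) (hG.const_mul b)]
  simp only [integral_const_mul]

/-- `∫ (2 Im(ᾱ z) + λ - s |V|²) U \bar K = 0` for all `K ∈ 𝓔`, together with the integrability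
properties of the terms of the stationary equation. -/
structure IsProfile (s lam : ℝ) (α : ℂ) (f V : ℂ → ℂ) : Prop where
  diff : Differentiable ℂ f
  memLp : MemLp (gaussMul f) 2 (volume : Measure ℂ)
  memLp_mul : MemLp (fun z => z * gaussMul f z) 2 (volume : Measure ℂ)
  memLp_deriv : MemLp (gaussMul (deriv f)) 2 (volume : Measure ℂ)
  memLp_cubic : MemLp (fun z => (‖V z‖ ^ 2 : ℂ) * gaussMul f z) 2 (volume : Measure ℂ)
  weak : ∀ k : ℂ → ℂ, Differentiable ℂ k → MemLp (gaussMul k) 2 (volume : Measure ℂ) →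
    ∫ z, ((2 * (conj α * z).im + lam - s * ‖V z‖ ^ 2 : ℝ) : ℂ) *
      (gaussMul f z * conj (gaussMul k z)) = 0

lemma MemL21.memLp {f : ℂ → ℂ} (hf : Differentiable ℂ f) (h : MemL21 (gaussMul f)) :
    MemLp (gaussMul f) 2 (volume : Measure ℂ) := by
  refine h.2.mono (continuous_gaussMul hf).aestronglyMeasurable (ae_of_all _ fun z => ?_)
  rw [norm_mul, norm_real, Real.norm_of_nonneg (Real.sqrt_nonneg _)]
  refine le_mul_of_one_le_left (norm_nonneg _) (Real.one_le_sqrt.2 ?_)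
  nlinarith [norm_nonneg z]

lemma MemL21.memLp_mul {f : ℂ → ℂ} (hf : Differentiable ℂ f) (h : MemL21 (gaussMul f)) :
    MemLp (fun z => z * gaussMul f z) 2 (volume : Measure ℂ) := by
  refine h.2.mono (continuous_id.mul (continuous_gaussMul hf)).aestronglyMeasurable
    (ae_of_all _ fun z => ?_)
  rw [norm_mul, norm_mul, norm_real, Real.norm_of_nonneg (Real.sqrt_nonneg _)]
  refine mul_le_mul_of_nonneg_right (Real.le_sqrt_of_sq_le ?_) (norm_nonneg _)
  linarith

/-- The time derivative at 0 contributes λU + iα e^{-|z|²/2}f' - iᾱzU. Against K ∈ 𝓔 the projection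
drops out and f' becomes z̄f, so the multiplier is λ + iαz̄ - iᾱz = λ + 2 Im(ᾱz). -/
lemma isProfile_of_solves {s lam mu : ℝ} {α : ℂ} (hα : α ≠ 0) {f V : ℂ → ℂ}
    (hf : Differentiable ℂ f) (hU : MemL21 (gaussMul f)) {u v : ℝ → fock}
    (hu : DifferentiableAt ℝ u 0)
    (hwu : ∀ t, ((u t : L2C) : ℂ → ℂ) =ᵐ[volume] wave lam α (gaussMul f) t)
    (hwv : ((v 0 : L2C) : ℂ → ℂ) =ᵐ[volume] wave mu α V 0)
    (heq : ∃ h : MemLp (fun z : ℂ => (‖(v 0 : L2C) z‖ ^ 2 : ℂ) * (u 0 : L2C) z) 2 volume,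
      I • deriv u 0 = (s : ℂ) • proj h.toLp) :
    IsProfile s lam α f V := by
  obtain ⟨hF, heq⟩ := heq
  have mU := hU.memLp hf
  have mzU := hU.memLp_mul hf
  have w0 : ∀ (l : ℝ) (W : ℂ → ℂ) z, wave l α W 0 z = W z := fun l W z => by simp [wave]
  have hd := deriv_ae_eq hu hwu (hasDerivAt_wave_gaussMul lam α hf)
  -- Since α ≠ 0, the formula for the time derivative can be solved for the f' term; all other terms
  -- are already in L².
  have mD : MemLp (gaussMul (deriv f)) 2 (volume : Measure ℂ) := by
    have h1 := ((((Lp.memLp (deriv u 0 : fock).1).ae_eq hd).add (mU.const_mul (I * lam))).add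
      (mzU.const_mul (conj α))).const_mul α⁻¹
    refine h1.ae_eq (ae_of_all _ fun z => ?_)
    simp only [Pi.add_apply]
    field_simp
    ring
  have hFe : (fun z : ℂ => (‖(v 0 : L2C) z‖ ^ 2 : ℂ) * (u 0 : L2C) z) =ᵐ[volume]
      fun z => (‖V z‖ ^ 2 : ℂ) * gaussMul f z := by
    filter_upwards [hwu 0, hwv] with z h1 h2
    rw [h1, h2, w0, w0]
  have mC := hF.ae_eq hFe
  refine ⟨hf, mU, mzU, mD, mC, fun k hk mk => ?_⟩
  have hkf : mk.toLp ∈ fock := ⟨gaussMul k, ⟨k, hk, fun z => rfl⟩, mk.coeFn_toLp⟩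
  have h1 : inner ℂ (mk.toLp : L2C) ((I • deriv u 0 : fock) : L2C) =
      s * inner ℂ (mk.toLp : L2C) (hF.toLp : L2C) := by
    have := Submodule.inner_orthogonalProjectionOnto_eq_of_mem_left (K := fock) ⟨_, hkf⟩ hF.toLp
    rw [heq, Submodule.coe_smul, inner_smul_right, ← this]
    rfl
  have i1 := integrable_mul_conj mU mk
  have i2 := integrable_mul_conj mD mk
  have i3 := integrable_mul_conj mzU mk
  have i4 := integrable_mul_conj mC mk
  have i5 := integrable_mul_conj mk mU
  have i6 := integrable_mul_conj mk mD
  have i7 := integrable_mul_conj mk mzU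
  have i8 : Integrable fun z => z * (gaussMul k z * conj (gaussMul f z)) := by
    refine (integrable_norm_iff ?_).1 ?_
    · exact (continuous_id.mul ((continuous_gaussMul hk).mul
        (continuous_conj.comp (continuous_gaussMul hf)))).aestronglyMeasurable
    · refine i7.norm.congr (ae_of_all _ fun z => ?_)
      simp only [norm_mul, RCLike.norm_conj]
      ring
  -- The derivative must sit on the unconjugated factor, so the adjointness identity is applied with
  -- f and k exchanged and then conjugated.
  have hadj : ∫ z, gaussMul (deriv f) z * conj (gaussMul k z) =
      ∫ z, conj z * (gaussMul f z * conj (gaussMul k z)) := by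
    have h := congrArg conj (integral_gaussMul_mul_conj_deriv hk hf i5 i6 i8)
    rw [← integral_conj, ← integral_conj] at h
    simpa only [map_mul, conj_conj, mul_comm] using h
  have i9 : Integrable fun z => conj z * (gaussMul f z * conj (gaussMul k z)) := by
    refine (conjCLE.integrable_comp_iff.2 i8).congr (ae_of_all _ fun z => ?_)
    simp only [conjCLE_apply, map_mul, conj_conj]
    ring
  have e1 : inner ℂ (mk.toLp : L2C) ((I • deriv u 0 : fock) : L2C) =
      ∫ z, (lam * (gaussMul f z * conj (gaussMul k z)) +
        I * α * (gaussMul (deriv f) z * conj (gaussMul k z)) -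
        I * conj α * (z * gaussMul f z * conj (gaussMul k z))) := by
    rw [L2.inner_def]
    refine integral_congr_ae ?_
    filter_upwards [mk.coeFn_toLp, hd, Lp.coeFn_smul I (deriv u 0 : fock).1] with z a1 a2 a3
    rw [a1, Submodule.coe_smul, a3, Pi.smul_apply, a2, RCLike.inner_apply, smul_eq_mul]
    linear_combination (-(lam : ℂ) * gaussMul f z * conj (gaussMul k z)) * I_mul_I
  have e2 : inner ℂ (mk.toLp : L2C) (hF.toLp : L2C) =
      ∫ z, (‖V z‖ ^ 2 : ℂ) * gaussMul f z * conj (gaussMul k z) := by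
    rw [L2.inner_def]
    refine integral_congr_ae ?_
    filter_upwards [mk.coeFn_toLp, hF.coeFn_toLp, hFe] with z a1 a2 a3
    rw [a1, a2, a3, RCLike.inner_apply]
  rw [e1, e2, integral_linearCombination _ _ _ i1 i2 i3, hadj] at h1
  have e3 : (fun z => ((2 * (conj α * z).im + lam - s * ‖V z‖ ^ 2 : ℝ) : ℂ) *
      (gaussMul f z * conj (gaussMul k z))) = fun z =>
      lam * (gaussMul f z * conj (gaussMul k z)) +
        I * α * (conj z * (gaussMul f z * conj (gaussMul k z))) -
        I * conj α * (z * gaussMul f z * conj (gaussMul k z)) -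
        s * ((‖V z‖ ^ 2 : ℂ) * gaussMul f z * conj (gaussMul k z)) := by
    funext z
    have hy : ((2 * (conj α * z).im : ℝ) : ℂ) = I * α * conj z - I * conj α * z := by
      apply Complex.ext
      · simp
        ring
      · simp
    have hc : ((2 * (conj α * z).im + lam - s * ‖V z‖ ^ 2 : ℝ) : ℂ) =
        ((2 * (conj α * z).im : ℝ) : ℂ) + lam - s * ‖V z‖ ^ 2 := by
      push_cast; ring
    rw [hc, hy]
    ring
  have i10 : Integrable fun z => lam * (gaussMul f z * conj (gaussMul k z)) +
      I * α * (conj z * (gaussMul f z * conj (gaussMul k z))) -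
      I * conj α * (z * gaussMul f z * conj (gaussMul k z)) :=
    ((i1.const_mul _).add (i9.const_mul _)).sub (i3.const_mul _)
  rw [e3, integral_sub i10
    (i4.const_mul _), integral_linearCombination _ _ _ i1 i9 i3, h1, integral_const_mul,
    sub_self]

/-! ### Conservation identities for a profile -/

lemma integrable_of_norm_le {E : Type*} [NormedAddCommGroup E] {F : ℂ → E} (hF : Continuous F)
    {a b : ℂ → ℂ} (ha : MemLp a 2 (volume : Measure ℂ)) (hb : MemLp b 2 (volume : Measure ℂ))
    (C : ℝ) (h : ∀ z, ‖F z‖ ≤ C * (‖a z‖ * ‖b z‖)) : Integrable F := by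
  have h1 := (integrable_mul_conj ha hb).norm.const_mul C
  refine h1.mono' hF.aestronglyMeasurable (ae_of_all _ fun z => ?_)
  simpa only [norm_mul, RCLike.norm_conj] using h z

lemma gaussMul_id_mul (f : ℂ → ℂ) : gaussMul (fun z => z * f z) = fun z => z * gaussMul f z := by
  funext z
  unfold gaussMul
  ring

lemma gaussMul_mul_conj_self (f : ℂ → ℂ) (z : ℂ) :
    gaussMul f z * conj (gaussMul f z) = ((‖gaussMul f z‖ ^ 2 : ℝ) : ℂ) := by
  rw [mul_conj']
  push_cast
  rfl

lemma abs_im_conj_mul_le (α z : ℂ) : |(conj α * z).im| ≤ ‖α‖ * ‖z‖ :=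
  (abs_im_le_norm _).trans (by rw [norm_mul, RCLike.norm_conj])

lemma continuous_im_conj_mul (α : ℂ) : Continuous fun z : ℂ => (conj α * z).im :=
  continuous_im.comp (continuous_const.mul continuous_id)

/-- The component `∫ Im(ᾱ z) |U|²` of the momentum. -/
def momIm (α : ℂ) (U : ℂ → ℂ) : ℝ := ∫ z, (conj α * z).im * ‖U z‖ ^ 2

section Profile

variable {s lam : ℝ} {α : ℂ} {f g : ℂ → ℂ}

lemma IsProfile.cont (h : IsProfile s lam α f (gaussMul g)) : Continuous (gaussMul f) :=
  continuous_gaussMul h.diff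

lemma IsProfile.integrable_sq (h : IsProfile s lam α f (gaussMul g)) :
    Integrable fun z => ‖gaussMul f z‖ ^ 2 :=
  integrable_of_norm_le (h.cont.norm.pow 2) h.memLp h.memLp 1 fun z => by
    rw [Real.norm_of_nonneg (by positivity)]
    exact le_of_eq (by ring)

lemma IsProfile.integrable_im_sq (h : IsProfile s lam α f (gaussMul g)) :
    Integrable fun z => (conj α * z).im * ‖gaussMul f z‖ ^ 2 :=
  integrable_of_norm_le ((continuous_im_conj_mul α).mul (h.cont.norm.pow 2)) h.memLp_mul h.memLp
    ‖α‖ fun z => by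
    rw [norm_mul, norm_mul, Real.norm_eq_abs, Real.norm_of_nonneg (by positivity)]
    calc _ ≤ ‖α‖ * ‖z‖ * ‖gaussMul f z‖ ^ 2 :=
          mul_le_mul_of_nonneg_right (abs_im_conj_mul_le α z) (by positivity)
      _ = _ := by ring

lemma IsProfile.integrable_im_sq_sq (h : IsProfile s lam α f (gaussMul g)) :
    Integrable fun z => (conj α * z).im ^ 2 * ‖gaussMul f z‖ ^ 2 :=
  integrable_of_norm_le (((continuous_im_conj_mul α).pow 2).mul (h.cont.norm.pow 2)) h.memLp_mul
    h.memLp_mul (‖α‖ ^ 2) fun z => by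
    rw [norm_mul, norm_mul, norm_pow, Real.norm_eq_abs, Real.norm_of_nonneg (by positivity)]
    calc _ ≤ (‖α‖ * ‖z‖) ^ 2 * ‖gaussMul f z‖ ^ 2 := by
          gcongr
          exact abs_im_conj_mul_le α z
      _ = _ := by ring

lemma IsProfile.integrable_quartic (h : IsProfile s lam α f (gaussMul g)) (hg : Differentiable ℂ g) :
    Integrable fun z => ‖gaussMul g z‖ ^ 2 * ‖gaussMul f z‖ ^ 2 :=
  integrable_of_norm_le (((continuous_gaussMul hg).norm.pow 2).mul (h.cont.norm.pow 2))
    h.memLp_cubic h.memLp 1 fun z => by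
    rw [Real.norm_of_nonneg (by positivity), norm_mul, norm_pow, norm_real, norm_norm]
    exact le_of_eq (by ring)

lemma IsProfile.integrable_im_quartic (h : IsProfile s lam α f (gaussMul g))
    (hg : Differentiable ℂ g) :
    Integrable fun z => (conj α * z).im * (‖gaussMul g z‖ ^ 2 * ‖gaussMul f z‖ ^ 2) :=
  integrable_of_norm_le ((continuous_im_conj_mul α).mul
    (((continuous_gaussMul hg).norm.pow 2).mul (h.cont.norm.pow 2)))
    h.memLp_cubic h.memLp_mul ‖α‖ fun z => by
    have hn : 0 ≤ ‖gaussMul g z‖ ^ 2 * ‖gaussMul f z‖ ^ 2 := by positivity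
    rw [norm_mul, Real.norm_of_nonneg hn, norm_mul, norm_pow, norm_real, norm_norm,
      norm_mul, Real.norm_eq_abs]
    calc _ ≤ ‖α‖ * ‖z‖ * (‖gaussMul g z‖ ^ 2 * ‖gaussMul f z‖ ^ 2) :=
          mul_le_mul_of_nonneg_right (abs_im_conj_mul_le α z) (by positivity)
      _ = _ := by ring

lemma IsProfile.energy (h : IsProfile s lam α f (gaussMul g)) (hg : Differentiable ℂ g) :
    lam * mass (gaussMul f) + 2 * momIm α (gaussMul f) = s * ham (gaussMul f) (gaussMul g) := by
  have h1 := h.weak f h.diff h.memLp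
  simp_rw [gaussMul_mul_conj_self, ← ofReal_mul] at h1
  rw [integral_complex_ofReal, ofReal_eq_zero] at h1
  have e : (fun z => (2 * (conj α * z).im + lam - s * ‖gaussMul g z‖ ^ 2) * ‖gaussMul f z‖ ^ 2) =
      fun z => 2 * ((conj α * z).im * ‖gaussMul f z‖ ^ 2) + lam * ‖gaussMul f z‖ ^ 2 -
        s * (‖gaussMul g z‖ ^ 2 * ‖gaussMul f z‖ ^ 2) := by
    funext z; ring
  rw [e, integral_sub ((h.integrable_im_sq.const_mul _).fun_add (h.integrable_sq.const_mul _))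
    ((h.integrable_quartic hg).const_mul _),
    integral_add (h.integrable_im_sq.const_mul _) (h.integrable_sq.const_mul _)] at h1
  simp only [integral_const_mul] at h1
  have e2 : ham (gaussMul f) (gaussMul g) = ∫ z, ‖gaussMul g z‖ ^ 2 * ‖gaussMul f z‖ ^ 2 := by
    unfold ham
    simp_rw [mul_comm]
  unfold mass momIm
  rw [e2]
  linarith

/-- Testing with zU puts z̄ in the integrand; the symbol is real, so conjugating turns it into z. -/
lemma IsProfile.weak_mul (h : IsProfile s lam α f (gaussMul g)) :
    ∫ z, ((2 * (conj α * z).im + lam - s * ‖gaussMul g z‖ ^ 2 : ℝ) : ℂ) *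
      (z * (gaussMul f z * conj (gaussMul f z))) = 0 := by
  have h1 := h.weak (fun z => z * f z) (differentiable_id.mul h.diff)
    (by rw [gaussMul_id_mul]; exact h.memLp_mul)
  have h2 := congrArg conj h1
  rw [← integral_conj, map_zero] at h2
  rw [← h2]
  congr 1
  funext z
  simp only [gaussMul_id_mul, map_mul, conj_ofReal, conj_conj]
  ring

/-- Multiplying `IsProfile.weak_mul` by ᾱ and taking imaginary parts replaces the factor z by
Im(ᾱz). -/
lemma IsProfile.second_moment (h : IsProfile s lam α f (gaussMul g)) (hg : Differentiable ℂ g) :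
    2 * (∫ z, (conj α * z).im ^ 2 * ‖gaussMul f z‖ ^ 2) + lam * momIm α (gaussMul f) =
      s * ∫ z, (conj α * z).im * (‖gaussMul g z‖ ^ 2 * ‖gaussMul f z‖ ^ 2) := by
  have h1 := h.weak_mul
  have h2 : ∫ z, (conj α * z).im *
      ((2 * (conj α * z).im + lam - s * ‖gaussMul g z‖ ^ 2) * ‖gaussMul f z‖ ^ 2) = 0 := by
    have h3 := congrArg (fun c => (conj α * c).im) h1
    simp only [← integral_const_mul, mul_zero, zero_im] at h3
    have hint : Integrable fun z => conj α *
        (((2 * (conj α * z).im + lam - s * ‖gaussMul g z‖ ^ 2 : ℝ) : ℂ) *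
          (z * (gaussMul f z * conj (gaussMul f z)))) := by
      have hc := continuous_im_conj_mul α
      have hgc := continuous_gaussMul hg
      have hfc := h.cont
      have i1 : Integrable fun z => z * (gaussMul f z * conj (gaussMul f z)) :=
        (integrable_mul_conj h.memLp_mul h.memLp).congr (ae_of_all _ fun z => by ring)
      have i2 : Integrable fun z => ((conj α * z).im : ℂ) *
          (z * (gaussMul f z * conj (gaussMul f z))) := by
        refine integrable_of_norm_le (by fun_prop) h.memLp_mul h.memLp_mul ‖α‖ fun z => ?_
        simp only [norm_mul, RCLike.norm_conj, norm_real, Real.norm_eq_abs]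
        calc _ ≤ ‖α‖ * ‖z‖ * (‖z‖ * (‖gaussMul f z‖ * ‖gaussMul f z‖)) :=
              mul_le_mul_of_nonneg_right (abs_im_conj_mul_le α z) (by positivity)
          _ = _ := by ring
      -- Pairing the cubic term with z̄U rather than zU makes the conjugation in the product restore
      -- the factor z.
      have i3 : Integrable fun z => ((‖gaussMul g z‖ : ℂ) ^ 2 * gaussMul f z) *
          conj (conj z * gaussMul f z) :=
        integrable_mul_conj h.memLp_cubic (h.memLp_mul.mono
          (by fun_prop) (ae_of_all _ fun z => by simp))
      refine ((((i2.const_mul 2).add (i1.const_mul lam)).sub (i3.const_mul s)).const_mul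
        (conj α)).congr (ae_of_all _ fun z => ?_)
      simp only [Pi.add_apply, Pi.sub_apply, map_mul, conj_conj]
      push_cast
      ring
    have h4 := (imCLM.integral_comp_comm hint)
    simp only [imCLM_apply] at h4
    rw [h3] at h4
    rw [← h4]
    congr 1
    funext z
    rw [gaussMul_mul_conj_self]
    rw [show conj α * (((2 * (conj α * z).im + lam - s * ‖gaussMul g z‖ ^ 2 : ℝ) : ℂ) *
      (z * ((‖gaussMul f z‖ ^ 2 : ℝ) : ℂ))) = (((2 * (conj α * z).im + lam -
      s * ‖gaussMul g z‖ ^ 2) * ‖gaussMul f z‖ ^ 2 : ℝ) : ℂ) * (conj α * z) by push_cast; ring,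
      im_ofReal_mul]
    ring
  have e : (fun z => (conj α * z).im *
      ((2 * (conj α * z).im + lam - s * ‖gaussMul g z‖ ^ 2) * ‖gaussMul f z‖ ^ 2)) =
      fun z => 2 * ((conj α * z).im ^ 2 * ‖gaussMul f z‖ ^ 2) +
        lam * ((conj α * z).im * ‖gaussMul f z‖ ^ 2) -
        s * ((conj α * z).im * (‖gaussMul g z‖ ^ 2 * ‖gaussMul f z‖ ^ 2)) := by
    funext z; ring
  rw [e, integral_sub ((h.integrable_im_sq_sq.const_mul _).fun_add (h.integrable_im_sq.const_mul _))
    ((h.integrable_im_quartic hg).const_mul _),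
    integral_add (h.integrable_im_sq_sq.const_mul _) (h.integrable_im_sq.const_mul _)] at h2
  simp only [integral_const_mul] at h2
  unfold momIm
  linarith

lemma IsProfile.integrable_dbar (h : IsProfile s lam α f (gaussMul g)) :
    Integrable (dbar fun w => gaussMul f w * conj (gaussMul f w)) := by
  rw [funext (dbar_gaussMul_mul_conj h.diff h.diff)]
  refine (integrable_mul_conj h.memLp h.memLp_deriv).sub ?_
  exact (integrable_mul_conj h.memLp_mul h.memLp).congr (ae_of_all _ fun z => by ring)

lemma IsProfile.integrable_sq_mul_dbar (h : IsProfile s lam α f (gaussMul g)) :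
    Integrable fun z => (‖gaussMul g z‖ ^ 2 : ℂ) *
      dbar (fun w => gaussMul f w * conj (gaussMul f w)) z := by
  simp_rw [dbar_gaussMul_mul_conj h.diff h.diff]
  have hfc := h.cont
  have i3 : Integrable fun z => ((‖gaussMul g z‖ : ℂ) ^ 2 * gaussMul f z) *
      conj (conj z * gaussMul f z) :=
    integrable_mul_conj h.memLp_cubic (h.memLp_mul.mono
      (by fun_prop) (ae_of_all _ fun z => by simp))
  refine ((integrable_mul_conj h.memLp_cubic h.memLp_deriv).sub i3).congr
    (ae_of_all _ fun z => ?_)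
  simp only [Pi.sub_apply, map_mul, conj_conj]
  ring

/-- The test functions e^{-|z|²/2}f' and zU together show that the symbol annihilates ∂_z̄|U|². The
affine part 2 Im(ᾱz) + λ is then integrated by parts, and its ∂_z̄ is the constant iα. -/
lemma IsProfile.speed_identity (h : IsProfile s lam α f (gaussMul g))
    (hg : Differentiable ℂ g) :
    s * (∫ z, (‖gaussMul g z‖ ^ 2 : ℂ) * dbar (fun w => gaussMul f w * conj (gaussMul f w)) z) =
      -(I * α * mass (gaussMul f)) := by
  set D := dbar fun w => gaussMul f w * conj (gaussMul f w) with hD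
  have hDe : ∀ z, D z = gaussMul f z * conj (gaussMul (deriv f) z) -
      z * (gaussMul f z * conj (gaussMul f z)) := dbar_gaussMul_mul_conj h.diff h.diff
  have hfc := h.cont
  have hc := continuous_im_conj_mul α
  have hgc := continuous_gaussMul hg
  have hdc : Continuous (gaussMul (deriv f)) :=
    continuous_gaussMul fun z => (h.diff.contDiff (n := 2)).differentiable_deriv_two z
  have iD : Integrable D := h.integrable_dbar
  have iVD : Integrable fun z => (‖gaussMul g z‖ ^ 2 : ℂ) * D z := h.integrable_sq_mul_dbar
  have iy1 : Integrable fun z => ((conj α * z).im : ℂ) *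
      (gaussMul f z * conj (gaussMul (deriv f) z)) := by
    refine integrable_of_norm_le (by fun_prop) h.memLp_mul h.memLp_deriv ‖α‖ fun z => ?_
    simp only [norm_mul, RCLike.norm_conj, norm_real, Real.norm_eq_abs]
    calc _ ≤ ‖α‖ * ‖z‖ * (‖gaussMul f z‖ * ‖gaussMul (deriv f) z‖) :=
          mul_le_mul_of_nonneg_right (abs_im_conj_mul_le α z) (by positivity)
      _ = _ := by ring
  have iy2 : Integrable fun z => ((conj α * z).im : ℂ) *
      (z * (gaussMul f z * conj (gaussMul f z))) := by
    refine integrable_of_norm_le (by fun_prop) h.memLp_mul h.memLp_mul ‖α‖ fun z => ?_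
    simp only [norm_mul, RCLike.norm_conj, norm_real, Real.norm_eq_abs]
    calc _ ≤ ‖α‖ * ‖z‖ * (‖z‖ * (‖gaussMul f z‖ * ‖gaussMul f z‖)) :=
          mul_le_mul_of_nonneg_right (abs_im_conj_mul_le α z) (by positivity)
      _ = _ := by ring
  have iyD : Integrable fun z => ((conj α * z).im : ℂ) * D z := by
    refine (iy1.sub iy2).congr (ae_of_all _ fun z => ?_)
    simp only [Pi.sub_apply, hDe]
    ring
  have iV1 := integrable_mul_conj h.memLp_cubic h.memLp_deriv
  have i1 := integrable_mul_conj h.memLp h.memLp_deriv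
  have iA : Integrable fun z => ((2 * (conj α * z).im + lam - s * ‖gaussMul g z‖ ^ 2 : ℝ) : ℂ) *
      (gaussMul f z * conj (gaussMul (deriv f) z)) := by
    refine (((iy1.const_mul 2).add (i1.const_mul lam)).sub (iV1.const_mul s)).congr
      (ae_of_all _ fun z => ?_)
    simp only [Pi.add_apply, Pi.sub_apply]
    push_cast
    ring
  have iT : Integrable fun z => (2 * ((conj α * z).im : ℂ) + lam) * D z := by
    refine ((iyD.const_mul 2).add (iD.const_mul lam)).congr (ae_of_all _ fun z => ?_)
    simp only [Pi.add_apply]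
    ring
  have iC : Integrable fun z => ((2 * (conj α * z).im + lam - s * ‖gaussMul g z‖ ^ 2 : ℝ) : ℂ) *
      D z := by
    refine (iT.sub (iVD.const_mul s)).congr (ae_of_all _ fun z => ?_)
    simp only [Pi.sub_apply]
    push_cast
    ring
  have iB : Integrable fun z => ((2 * (conj α * z).im + lam - s * ‖gaussMul g z‖ ^ 2 : ℝ) : ℂ) *
      (z * (gaussMul f z * conj (gaussMul f z))) := by
    refine (iA.sub iC).congr (ae_of_all _ fun z => ?_)
    simp only [Pi.sub_apply, hDe]
    ring
  have hA := h.weak (deriv f) ((h.diff.contDiff (n := 2)).differentiable_deriv_two) h.memLp_deriv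
  have hC : ∫ z, ((2 * (conj α * z).im + lam - s * ‖gaussMul g z‖ ^ 2 : ℝ) : ℂ) * D z = 0 := by
    have := integral_sub iA iB
    rw [hA, h.weak_mul, sub_zero] at this
    rw [← this]
    congr 1
    funext z
    rw [hDe]
    ring
  have hsplit : s * (∫ z, (‖gaussMul g z‖ ^ 2 : ℂ) * D z) =
      ∫ z, (2 * ((conj α * z).im : ℂ) + lam) * D z := by
    have := integral_sub iT (iVD.const_mul s)
    rw [integral_const_mul] at this
    rw [eq_comm, ← sub_eq_zero, ← this, ← hC]
    congr 1
    funext z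
    push_cast
    ring
  have hy : ∀ z : ℂ, 2 * ((conj α * z).im : ℂ) = I * α * conj z - I * conj α * z := by
    intro z
    apply Complex.ext
    · simp
      ring
    · simp
  -- The function is iαz̄ plus a holomorphic function.
  have hdy : ∀ z, dbar (fun w => 2 * ((conj α * w).im : ℂ) + lam) z = I * α := by
    intro z
    have hconj : DifferentiableAt ℝ (fun w : ℂ => conj w) z :=
      differentiable_conj_comp (b := fun w => w) differentiable_id z
    have e1 : (fun w : ℂ => 2 * ((conj α * w).im : ℂ) + lam) =
        fun w => (I * α) * conj w + (-(I * conj α) * w + lam) := by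
      funext w
      rw [hy]
      ring
    have d1 : DifferentiableAt ℝ (fun w : ℂ => (I * α) * conj w) z := hconj.const_mul _
    have d2 : DifferentiableAt ℂ (fun w : ℂ => -(I * conj α) * w + lam) z := by fun_prop
    have e2 : dbar (fun w : ℂ => (I * α) * conj w + (-(I * conj α) * w + lam)) z =
        dbar (fun w : ℂ => (I * α) * conj w) z + dbar (fun w => -(I * conj α) * w + lam) z := by
      unfold dbar
      rw [fderiv_fun_add d1 (d2.restrictScalars ℝ)]
      simp only [_root_.add_apply]
      ring
    rw [e1, e2, dbar_of_differentiableAt d2,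
      dbar_mul (differentiableAt_const _) hconj,
      dbar_of_differentiableAt (differentiableAt_const _),
      dbar_conj_of_differentiableAt (b := fun w => w) differentiableAt_id, deriv_id'']
    simp
  have cy : ContDiff ℝ 1 fun w : ℂ => 2 * ((conj α * w).im : ℂ) + lam := by
    have : ContDiff ℝ 1 fun w : ℂ => (conj α * w).im :=
      imCLM.contDiff.comp (contDiff_const.mul contDiff_id)
    exact (contDiff_const.mul (ofRealCLM.contDiff.comp this)).add contDiff_const
  have cU := contDiff_gaussMul_mul_conj h.diff h.diff
  have hdW : ∀ z, dbar (fun w => (2 * ((conj α * w).im : ℂ) + lam) *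
      (gaussMul f w * conj (gaussMul f w))) z =
      I * α * (gaussMul f z * conj (gaussMul f z)) + (2 * ((conj α * z).im : ℂ) + lam) * D z := by
    intro z
    rw [dbar_mul (cy.differentiable one_ne_zero z) (cU.differentiable one_ne_zero z), hdy]
  have i0 := integrable_mul_conj h.memLp h.memLp
  have iW : Integrable fun w => (2 * ((conj α * w).im : ℂ) + lam) *
      (gaussMul f w * conj (gaussMul f w)) := by
    refine ((h.integrable_im_sq.ofReal.const_mul (2 : ℂ)).add (i0.const_mul lam)).congr
      (ae_of_all _ fun z => ?_)
    simp only [Pi.add_apply, gaussMul_mul_conj_self, ofReal_mul, ofReal_pow, coe_algebraMap]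
    ring
  have h0 := integral_dbar_eq_zero (cy.mul cU) iW (by
    rw [funext hdW]
    exact (i0.const_mul _).add iT)
  simp_rw [hdW] at h0
  rw [integral_add (i0.const_mul _) iT, integral_const_mul] at h0
  simp_rw [gaussMul_mul_conj_self] at h0
  rw [integral_complex_ofReal] at h0
  rw [hsplit]
  unfold mass
  linear_combination h0

/-- The weight vanishes only on a line, so the function vanishes off that line, and continuity does
the rest. -/
lemma eq_zero_of_integral_mul_sq_eq_zero (hf : Differentiable ℂ f) (hα : α ≠ 0) (c : ℝ)
    (hi : Integrable fun z => ((conj α * z).im - c) ^ 2 * ‖gaussMul f z‖ ^ 2)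
    (h : ∫ z, ((conj α * z).im - c) ^ 2 * ‖gaussMul f z‖ ^ 2 = 0) : gaussMul f = 0 := by
  have hfc := continuous_gaussMul hf
  have hc := continuous_im_conj_mul α
  have hcont : Continuous fun z => ((conj α * z).im - c) ^ 2 * ‖gaussMul f z‖ ^ 2 := by fun_prop
  rw [integral_eq_zero_iff_of_nonneg (fun z => by positivity) hi,
    hcont.ae_eq_iff_eq volume continuous_zero] at h
  have h1 : ∀ z, (conj α * z).im ≠ c → gaussMul f z = 0 := by
    intro z hz
    have h2 : ((conj α * z).im - c) ^ 2 * ‖gaussMul f z‖ ^ 2 = 0 := congrFun h z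
    have h3 := (mul_eq_zero.1 h2).resolve_left (pow_ne_zero 2 (sub_ne_zero.2 hz))
    simpa using h3
  funext z
  -- Moving in the direction iα increases Im(ᾱz) at rate |α|², so the approximating points leave the
  -- line.
  have hline : Tendsto (fun n : ℕ => gaussMul f (z + (I * α) * ((((n : ℝ) + 1)⁻¹ : ℝ) : ℂ)))
      atTop (𝓝 (gaussMul f z)) := by
    have h0 : Tendsto (fun n : ℕ => ((n : ℝ) + 1)⁻¹) atTop (𝓝 0) := by
      simpa [one_div] using tendsto_one_div_add_atTop_nhds_zero_nat (𝕜 := ℝ)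
    have h2 : Tendsto (fun n : ℕ => z + (I * α) * ((((n : ℝ) + 1)⁻¹ : ℝ) : ℂ)) atTop (𝓝 z) := by
      have := ((continuous_ofReal.tendsto 0).comp h0).const_mul (I * α) |>.const_add z
      simpa [Function.comp_def] using this
    exact (hfc.tendsto z).comp h2
  by_cases hz : (conj α * z).im = c
  · refine tendsto_nhds_unique hline ?_
    refine tendsto_const_nhds.congr fun n => (h1 _ ?_).symm
    have e : conj α * (z + (I * α) * ((((n : ℝ) + 1)⁻¹ : ℝ) : ℂ)) =
        conj α * z + (((‖α‖ ^ 2 * ((n : ℝ) + 1)⁻¹ : ℝ) : ℂ)) * I := by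
      push_cast
      linear_combination (I * ((n : ℂ) + 1)⁻¹) * conj_mul' α
    rw [e, add_im, im_ofReal_mul, I_im, mul_one, hz]
    have : 0 < ‖α‖ ^ 2 * ((n : ℝ) + 1)⁻¹ := by
      have := norm_pos_iff.2 hα
      positivity
    linarith
  · exact h1 z hz

lemma eq_zero_of_mass_eq_zero (hf : Differentiable ℂ f)
    (hi : Integrable fun z => ‖gaussMul f z‖ ^ 2) (h : mass (gaussMul f) = 0) :
    gaussMul f = 0 := by
  have hcont : Continuous fun z => ‖gaussMul f z‖ ^ 2 := (continuous_gaussMul hf).norm.pow 2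
  unfold mass at h
  rw [integral_eq_zero_iff_of_nonneg (fun z => by positivity) hi,
    hcont.ae_eq_iff_eq volume continuous_zero] at h
  funext z
  simpa using congrFun h z

lemma IsProfile.integral_sub_sq (h : IsProfile s lam α f (gaussMul g)) (c : ℝ) :
    (Integrable fun z => ((conj α * z).im - c) ^ 2 * ‖gaussMul f z‖ ^ 2) ∧
    ∫ z, ((conj α * z).im - c) ^ 2 * ‖gaussMul f z‖ ^ 2 =
      (∫ z, (conj α * z).im ^ 2 * ‖gaussMul f z‖ ^ 2) - 2 * c * momIm α (gaussMul f) +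
        c ^ 2 * mass (gaussMul f) := by
  have e : (fun z => ((conj α * z).im - c) ^ 2 * ‖gaussMul f z‖ ^ 2) =
      fun z => (conj α * z).im ^ 2 * ‖gaussMul f z‖ ^ 2 -
        2 * c * ((conj α * z).im * ‖gaussMul f z‖ ^ 2) + c ^ 2 * ‖gaussMul f z‖ ^ 2 := by
    funext z; ring
  rw [e]
  have i1 := h.integrable_im_sq_sq
  have i2 := h.integrable_im_sq.const_mul (2 * c)
  have i3 := h.integrable_sq.const_mul (c ^ 2)
  have i4 : Integrable fun z => (conj α * z).im ^ 2 * ‖gaussMul f z‖ ^ 2 -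
      2 * c * ((conj α * z).im * ‖gaussMul f z‖ ^ 2) := i1.sub i2
  refine ⟨i4.fun_add i3, ?_⟩
  rw [integral_add i4 i3, integral_sub i1 i2]
  simp only [integral_const_mul]
  rfl

end Profile

/-- The opposite signs in the two equations make the speed identities add up to the integral of the
exact derivative ∂_z̄(|U|²|V|²). -/
lemma mass_eq_of_isProfile {lam mu : ℝ} {α : ℂ} (hα : α ≠ 0) {f g : ℂ → ℂ}
    (hU : IsProfile 1 lam α f (gaussMul g)) (hV : IsProfile (-1) mu α g (gaussMul f)) :
    mass (gaussMul f) = mass (gaussMul g) := by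
  have h1 := hU.speed_identity hV.diff
  have h2 := hV.speed_identity hU.diff
  have cU := contDiff_gaussMul_mul_conj hU.diff hU.diff
  have cV := contDiff_gaussMul_mul_conj hV.diff hV.diff
  have hd : ∀ z, dbar (fun w => (gaussMul f w * conj (gaussMul f w)) *
      (gaussMul g w * conj (gaussMul g w))) z =
      (‖gaussMul g z‖ ^ 2 : ℂ) * dbar (fun w => gaussMul f w * conj (gaussMul f w)) z +
      (‖gaussMul f z‖ ^ 2 : ℂ) * dbar (fun w => gaussMul g w * conj (gaussMul g w)) z := by
    intro z
    rw [dbar_mul (cU.differentiable one_ne_zero z) (cV.differentiable one_ne_zero z),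
      mul_conj', mul_conj']
    ring
  have i1 := hU.integrable_sq_mul_dbar
  have i2 := hV.integrable_sq_mul_dbar
  have h0 := integral_dbar_eq_zero (cU.mul cV) (by
    refine (hU.integrable_quartic hV.diff).ofReal.congr (ae_of_all _ fun z => ?_)
    simp only [gaussMul_mul_conj_self, ofReal_mul, ofReal_pow, coe_algebraMap]
    ring) (by rw [funext hd]; exact i1.add i2)
  simp_rw [hd] at h0
  rw [integral_add i1 i2] at h0
  push_cast at h1 h2
  have h3 : (I * α) * ((mass (gaussMul f) : ℂ) - mass (gaussMul g)) = 0 := by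
    linear_combination h1 - h2 - h0
  have h4 := (mul_eq_zero.1 h3).resolve_left (mul_ne_zero I_ne_zero hα)
  exact_mod_cast sub_eq_zero.1 h4

/-- If the moments agreed, the summed identities would make the total variance of Im(ᾱz) about its
mean Y/M vanish. -/
lemma momIm_ne_of_isProfile {lam mu : ℝ} {α : ℂ} (hα : α ≠ 0) {f g : ℂ → ℂ}
    (hU : IsProfile 1 lam α f (gaussMul g)) (hV : IsProfile (-1) mu α g (gaussMul f))
    (hne : mass (gaussMul f) ≠ 0) : momIm α (gaussMul f) ≠ momIm α (gaussMul g) := by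
  intro hY
  have hM := mass_eq_of_isProfile hα hU hV
  have e1 := hU.energy hV.diff
  have e2 := hV.energy hU.diff
  have s1 := hU.second_moment hV.diff
  have s2 := hV.second_moment hU.diff
  have hham : ham (gaussMul g) (gaussMul f) = ham (gaussMul f) (gaussMul g) := by
    unfold ham
    simp_rw [mul_comm]
  have hq : ∫ z, (conj α * z).im * (‖gaussMul f z‖ ^ 2 * ‖gaussMul g z‖ ^ 2) =
      ∫ z, (conj α * z).im * (‖gaussMul g z‖ ^ 2 * ‖gaussMul f z‖ ^ 2) := by
    congr 1
    funext z
    ring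
  rw [hham] at e2
  rw [hq] at s2
  rw [← hM, ← hY] at e2
  rw [← hY] at s2
  set M := mass (gaussMul f)
  set Y := momIm α (gaussMul f)
  obtain ⟨iU, cU⟩ := hU.integral_sub_sq (Y / M)
  obtain ⟨iV, cV⟩ := hV.integral_sub_sq (Y / M)
  have nU : 0 ≤ ∫ z, ((conj α * z).im - Y / M) ^ 2 * ‖gaussMul f z‖ ^ 2 :=
    integral_nonneg fun z => by positivity
  have nV : 0 ≤ ∫ z, ((conj α * z).im - Y / M) ^ 2 * ‖gaussMul g z‖ ^ 2 :=
    integral_nonneg fun z => by positivity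
  have hsum : (∫ z, ((conj α * z).im - Y / M) ^ 2 * ‖gaussMul f z‖ ^ 2) +
      (∫ z, ((conj α * z).im - Y / M) ^ 2 * ‖gaussMul g z‖ ^ 2) = 0 := by
    rw [cU, cV, ← hM, ← hY]
    -- Sum of the two energy identities; the Hamiltonian enters them with opposite signs.
    have hlm : lam + mu = -(4 * Y / M) := by
      field_simp
      linarith
    have hA : 2 * ((∫ z, (conj α * z).im ^ 2 * ‖gaussMul f z‖ ^ 2) +
        (∫ z, (conj α * z).im ^ 2 * ‖gaussMul g z‖ ^ 2)) = 4 * Y / M * Y := by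
      linear_combination s1 + s2 - Y * hlm
    have hB : (∫ z, (conj α * z).im ^ 2 * ‖gaussMul f z‖ ^ 2) +
        (∫ z, (conj α * z).im ^ 2 * ‖gaussMul g z‖ ^ 2) = 2 * Y / M * Y := by
      linear_combination hA / 2
    have hc : Y / M * M = Y := div_mul_cancel₀ _ hne
    linear_combination hB + 2 * (Y / M) * hc
  have := eq_zero_of_integral_mul_sq_eq_zero hU.diff hα _ iU (by linarith)
  exact hne (by simp [M, mass, this])

/-! ### Rotations -/

lemma norm_exp_I_mul_ofReal (θ : ℝ) : ‖exp (I * θ)‖ = 1 := by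
  rw [mul_comm, norm_exp_ofReal_mul_I]

lemma exp_I_mul_exp_neg (θ : ℝ) : exp (I * (-θ : ℝ)) * exp (I * θ) = 1 := by
  rw [← Complex.exp_add]
  simp

lemma measurePreserving_rot (θ : ℝ) :
    MeasurePreserving (fun z : ℂ => exp (I * θ) * z) volume volume := by
  have h := (rotation (Circle.exp θ)).measurePreserving
  have e : (fun z : ℂ => exp (I * θ) * z) = rotation (Circle.exp θ) := by
    funext z
    rw [rotation_apply, Circle.coe_exp, mul_comm I]
  rw [e]
  exact h

lemma measurableEmbedding_rot (θ : ℝ) : MeasurableEmbedding fun z : ℂ => exp (I * θ) * z :=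
  measurableEmbedding_mulLeft₀ (Complex.exp_ne_zero _)

lemma integral_comp_rot {E : Type*} [NormedAddCommGroup E] [NormedSpace ℝ E] (θ : ℝ) (F : ℂ → E) :
    ∫ z, F (exp (I * θ) * z) = ∫ z, F z :=
  (measurePreserving_rot θ).integral_comp (measurableEmbedding_rot θ) F

lemma rot_neg_rot (θ : ℝ) (U : ℂ → ℂ) (z : ℂ) : rot (-θ) U (exp (I * θ) * z) = U z := by
  unfold rot
  rw [← mul_assoc, exp_I_mul_exp_neg, one_mul]

lemma rot_gaussMul (θ : ℝ) (f : ℂ → ℂ) :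
    rot θ (gaussMul f) = gaussMul fun z => f (exp (I * θ) * z) := by
  funext z
  unfold rot gaussMul
  rw [norm_mul, norm_exp_I_mul_ofReal, one_mul]

lemma differentiable_comp_rot (θ : ℝ) {f : ℂ → ℂ} (hf : Differentiable ℂ f) :
    Differentiable ℂ fun z => f (exp (I * θ) * z) :=
  hf.comp (differentiable_id.const_mul _)

/-- A sub-mean-value bound on unit balls, made uniform in the center by a holomorphic change of
gauge. -/
lemma exists_norm_gaussMul_le {k : ℂ → ℂ} (hk : Differentiable ℂ k)
    (mk : MemLp (gaussMul k) 2 (volume : Measure ℂ)) : ∃ C, 0 ≤ C ∧ ∀ z, ‖gaussMul k z‖ ≤ C := by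
  have hint : Integrable fun w => ‖gaussMul k w‖ ^ 2 :=
    (memLp_two_iff_integrable_sq_norm mk.1).1 mk
  have hG : ∀ w, ‖gaussMul k w‖ ^ 2 = Real.exp (-‖w‖ ^ 2) * ‖k w‖ ^ 2 := by
    intro w
    unfold gaussMul
    rw [norm_mul, norm_real, Real.norm_of_nonneg (Real.exp_pos _).le, mul_pow, ← Real.exp_nat_mul]
    congr 2
    push_cast
    ring
  set N := ∫ w, ‖gaussMul k w‖ ^ 2
  have hN : 0 ≤ N := integral_nonneg fun w => by positivity
  have key : ∀ z, ‖gaussMul k z‖ ^ 2 ≤ Real.exp 1 * N := by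
    intro z
    -- With the factor e^{-z̄w} the Gaussian weight is compensated up to e^{|w-z|²}, which is at
    -- most e on the ball.
    have hd : Differentiable ℂ fun w => k w * exp (-(conj z * w)) := by fun_prop
    have h1 := norm_sq_le_integral_ball hd z
    have hn : ∀ w, ‖k w * exp (-(conj z * w))‖ ^ 2 =
        Real.exp (-‖z‖ ^ 2) * (Real.exp (‖w - z‖ ^ 2) * ‖gaussMul k w‖ ^ 2) := by
      intro w
      rw [hG, norm_mul, norm_exp, mul_pow, ← Real.exp_nat_mul, ← mul_assoc, ← mul_assoc,
        ← Real.exp_add, ← Real.exp_add, mul_comm]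
      congr 2
      simp only [Complex.sq_norm, normSq_apply, neg_re, mul_re, conj_re, conj_im, sub_re, sub_im]
      push_cast
      ring
    have h2 : ∫ w in Metric.ball z 1, ‖k w * exp (-(conj z * w))‖ ^ 2 ≤
        Real.exp (-‖z‖ ^ 2) * (Real.exp 1 * N) := by
      calc _ ≤ ∫ w in Metric.ball z 1, Real.exp (-‖z‖ ^ 2) *
            (Real.exp 1 * ‖gaussMul k w‖ ^ 2) := by
            refine setIntegral_mono_on ?_ ((hint.const_mul _).const_mul _).integrableOn
              Metric.isOpen_ball.measurableSet fun w hw => ?_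
            · exact ((hd.continuous.norm.pow 2).continuousOn.integrableOn_compact
                (isCompact_closedBall z 1)).mono_set Metric.ball_subset_closedBall
            · rw [hn]
              rw [Metric.mem_ball, dist_eq_norm] at hw
              have : ‖w - z‖ ^ 2 ≤ 1 := by nlinarith [norm_nonneg (w - z)]
              gcongr
        _ ≤ ∫ w, Real.exp (-‖z‖ ^ 2) * (Real.exp 1 * ‖gaussMul k w‖ ^ 2) :=
            setIntegral_le_integral ((hint.const_mul _).const_mul _)
              (ae_of_all _ fun w => by positivity)
        _ = _ := by rw [integral_const_mul, integral_const_mul]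
    have h3 := h1.trans h2
    rw [hn, sub_self, norm_zero] at h3
    have h4 : Real.exp (-‖z‖ ^ 2) * (Real.pi * ‖gaussMul k z‖ ^ 2) ≤
        Real.exp (-‖z‖ ^ 2) * (Real.exp 1 * N) := by
      refine le_trans (le_of_eq ?_) h3
      norm_num
      ring
    have h5 := le_of_mul_le_mul_left h4 (Real.exp_pos _)
    refine le_trans (le_mul_of_one_le_left (by positivity) ?_) h5
    linarith [Real.pi_gt_three]
  refine ⟨Real.sqrt (Real.exp 1 * N), Real.sqrt_nonneg _, fun z => ?_⟩
  exact Real.le_sqrt_of_sq_le (key z)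

/-- Mean value inequality in the angle: the Gaussian is rotation invariant, so only f is
differentiated, at the cost of a factor |z|. -/
lemma norm_gaussMul_sub_rot_le {f : ℂ → ℂ} (hf : Differentiable ℂ f) {C : ℝ}
    (hC : ∀ z, ‖gaussMul (deriv f) z‖ ≤ C) (θ : ℝ) (z : ℂ) :
    ‖gaussMul f z - rot θ (gaussMul f) z‖ ≤ C * ‖z‖ * |θ| := by
  have hd : ∀ t : ℝ, HasDerivAt (fun t : ℝ => rot t (gaussMul f) z)
      (I * exp (I * t) * z * rot t (gaussMul (deriv f)) z) t := by
    intro t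
    have h1 : HasDerivAt (fun s : ℂ => exp (I * s) * z) (exp (I * t) * (I * 1) * z) (t : ℂ) :=
      (((hasDerivAt_id (t : ℂ)).const_mul I).cexp).mul_const z
    have h2 : HasDerivAt f (deriv f (exp (I * t) * z)) (exp (I * t) * z) := (hf _).hasDerivAt
    have h3 := ((h2.comp (t : ℂ) h1).const_mul (Real.exp (-‖z‖ ^ 2 / 2) : ℂ)).comp_ofReal
    simp only [rot_gaussMul]
    unfold gaussMul
    refine h3.congr_deriv ?_
    ring
  have hb : ∀ t : ℝ, ‖I * exp (I * t) * z * rot t (gaussMul (deriv f)) z‖ ≤ C * ‖z‖ := by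
    intro t
    rw [norm_mul, norm_mul, norm_mul, norm_I, norm_exp_I_mul_ofReal, one_mul, one_mul, mul_comm]
    exact mul_le_mul_of_nonneg_right (hC _) (norm_nonneg z)
  have h := convex_univ.norm_image_sub_le_of_norm_hasDerivWithin_le
    (fun t _ => (hd t).hasDerivWithinAt) (fun t _ => hb t) (Set.mem_univ θ) (Set.mem_univ 0)
  have h0 : rot 0 (gaussMul f) z = gaussMul f z := by simp [rot]
  rw [h0] at h
  simpa using h

/-- The component `∫ Re(ᾱ z) |U|²` of the momentum. -/
def momRe (α : ℂ) (U : ℂ → ℂ) : ℝ := ∫ z, (conj α * z).re * ‖U z‖ ^ 2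

/-- The rotational increment `|U - L_θ U|²`. -/
def rotDiff (θ : ℝ) (U : ℂ → ℂ) (z : ℂ) : ℝ := ‖U z - rot θ U z‖ ^ 2

lemma rotDiff_neg (θ : ℝ) (U : ℂ → ℂ) (z : ℂ) :
    rotDiff (-θ) U (exp (I * θ) * z) = rotDiff θ U z := by
  unfold rotDiff
  rw [rot_neg_rot, norm_sub_rev]
  rfl

lemma rotDiff_le (θ : ℝ) (U : ℂ → ℂ) (z : ℂ) :
    rotDiff θ U z ≤ 2 * (‖U z‖ ^ 2 + ‖rot θ U z‖ ^ 2) := by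
  unfold rotDiff
  have h := norm_sub_le (U z) (rot θ U z)
  nlinarith [norm_nonneg (U z - rot θ U z), sq_nonneg (‖U z‖ - ‖rot θ U z‖)]

/-! ### Testing the stationary equation against rotated profiles. -/

section Rot

variable {s lam : ℝ} {α : ℂ} {f g : ℂ → ℂ}

lemma memLp_rot (θ : ℝ) {u : ℂ → ℂ} (hu : MemLp u 2 (volume : Measure ℂ)) :
    MemLp (rot θ u) 2 (volume : Measure ℂ) :=
  hu.comp_measurePreserving (measurePreserving_rot θ)

lemma memLp_mul_rot (θ : ℝ) {u : ℂ → ℂ} (hu : MemLp (fun z => z * u z) 2 (volume : Measure ℂ)) :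
    MemLp (fun z => z * rot θ u z) 2 (volume : Measure ℂ) := by
  refine ((hu.comp_measurePreserving (measurePreserving_rot θ)).const_mul
    (exp (I * (-θ : ℝ)))).ae_eq (ae_of_all _ fun z => ?_)
  simp only [Function.comp_apply, rot]
  linear_combination (z * u (exp (I * θ) * z)) * exp_I_mul_exp_neg θ

lemma continuous_rot (θ : ℝ) {u : ℂ → ℂ} (hu : Continuous u) : Continuous (rot θ u) := by
  unfold rot
  fun_prop

lemma IsProfile.memLp_sub_rot (h : IsProfile s lam α f (gaussMul g)) (θ : ℝ) :
    MemLp (fun z => gaussMul f z - rot θ (gaussMul f) z) 2 (volume : Measure ℂ) :=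
  h.memLp.sub (memLp_rot θ h.memLp)

lemma IsProfile.memLp_mul_sub_rot (h : IsProfile s lam α f (gaussMul g)) (θ : ℝ) :
    MemLp (fun z => z * (gaussMul f z - rot θ (gaussMul f) z)) 2 (volume : Measure ℂ) :=
  (h.memLp_mul.sub (memLp_mul_rot θ h.memLp_mul)).ae_eq (ae_of_all _ fun z => by
    simp only [Pi.sub_apply]
    ring)

lemma integrable_sq_of_memLp {u : ℂ → ℂ} (hu : MemLp u 2 (volume : Measure ℂ)) :
    Integrable fun z => ‖u z‖ ^ 2 :=
  (memLp_two_iff_integrable_sq_norm hu.1).1 hu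

lemma integrable_linear_mul_sq {u : ℂ → ℂ} (hc : Continuous u) {a : ℂ → ℝ} (ha : Continuous a)
    {A : ℝ} (hA : ∀ z, |a z| ≤ A * ‖z‖) (h1 : MemLp u 2 (volume : Measure ℂ))
    (h2 : MemLp (fun z => z * u z) 2 (volume : Measure ℂ)) :
    Integrable fun z => a z * ‖u z‖ ^ 2 :=
  integrable_of_norm_le (ha.mul (hc.norm.pow 2)) h2 h1 A fun z => by
    rw [norm_mul, norm_mul, Real.norm_eq_abs, Real.norm_of_nonneg (by positivity)]
    calc _ ≤ A * ‖z‖ * ‖u z‖ ^ 2 := mul_le_mul_of_nonneg_right (hA z) (by positivity)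
      _ = _ := by ring

lemma integrable_bdd_mul_sq {u v : ℂ → ℂ} (hcu : Continuous u) (hcv : Continuous v)
    {C : ℝ} (hC : ∀ z, ‖u z‖ ≤ C) (h : MemLp v 2 (volume : Measure ℂ)) :
    Integrable fun z => ‖v z‖ ^ 2 * ‖u z‖ ^ 2 :=
  integrable_of_norm_le ((hcv.norm.pow 2).mul (hcu.norm.pow 2)) h h (C ^ 2) fun z => by
    rw [Real.norm_of_nonneg (by positivity)]
    have := pow_le_pow_left₀ (norm_nonneg _) (hC z) 2
    nlinarith [sq_nonneg ‖v z‖]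

lemma im_rot_neg (α : ℂ) (θ : ℝ) (z : ℂ) : (conj α * (exp (I * (-θ : ℝ)) * z)).im =
    Real.cos θ * (conj α * z).im - Real.sin θ * (conj α * z).re := by
  have : exp (I * (-θ : ℝ)) = Real.cos θ - Real.sin θ * I := by
    rw [mul_comm, Complex.exp_mul_I, ← ofReal_cos, ← ofReal_sin, Real.cos_neg, Real.sin_neg]
    push_cast
    ring
  rw [this]
  simp only [mul_re, mul_im, sub_re, sub_im, ofReal_re, ofReal_im, I_re, I_im, conj_re, conj_im]
  ring

lemma IsProfile.integral_im_rot_sq (h : IsProfile s lam α f (gaussMul g)) (θ : ℝ) :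
    ∫ z, (conj α * z).im * ‖rot θ (gaussMul f) z‖ ^ 2 =
      Real.cos θ * momIm α (gaussMul f) - Real.sin θ * momRe α (gaussMul f) := by
  have hre : Integrable fun z => (conj α * z).re * ‖gaussMul f z‖ ^ 2 :=
    integrable_linear_mul_sq h.cont (continuous_re.comp (continuous_const.mul continuous_id))
      (A := ‖α‖) (fun z => (abs_re_le_norm _).trans (by rw [norm_mul, RCLike.norm_conj]))
      h.memLp h.memLp_mul
  rw [← integral_comp_rot (-θ)]
  have e : (fun z => (conj α * (exp (I * (-θ : ℝ)) * z)).im *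
      ‖rot θ (gaussMul f) (exp (I * (-θ : ℝ)) * z)‖ ^ 2) = fun z =>
      Real.cos θ * ((conj α * z).im * ‖gaussMul f z‖ ^ 2) -
        Real.sin θ * ((conj α * z).re * ‖gaussMul f z‖ ^ 2) := by
    funext z
    have := rot_neg_rot (-θ) (gaussMul f) z
    rw [neg_neg] at this
    rw [this, im_rot_neg]
    ring
  rw [e, integral_sub (h.integrable_im_sq.const_mul _) (hre.const_mul _)]
  simp only [integral_const_mul]
  rfl

lemma norm_exp_I_mul_sub_one_le (θ : ℝ) : ‖exp (I * θ) - 1‖ ≤ |θ| :=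
  Real.norm_exp_I_mul_ofReal_sub_one_le

lemma integral_symbol_mul_sq (s lam : ℝ) (α : ℂ) {u v : ℂ → ℂ} (hc : Continuous u)
    (h1 : MemLp u 2 (volume : Measure ℂ)) (h2 : MemLp (fun z => z * u z) 2 (volume : Measure ℂ))
    (h3 : Integrable fun z => ‖v z‖ ^ 2 * ‖u z‖ ^ 2) :
    (Integrable fun z => (2 * (conj α * z).im + lam - s * ‖v z‖ ^ 2) * ‖u z‖ ^ 2) ∧
    ∫ z, (2 * (conj α * z).im + lam - s * ‖v z‖ ^ 2) * ‖u z‖ ^ 2 =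
      2 * (∫ z, (conj α * z).im * ‖u z‖ ^ 2) + lam * (∫ z, ‖u z‖ ^ 2) -
        s * ∫ z, ‖v z‖ ^ 2 * ‖u z‖ ^ 2 := by
  have e : (fun z => (2 * (conj α * z).im + lam - s * ‖v z‖ ^ 2) * ‖u z‖ ^ 2) =
      fun z => 2 * ((conj α * z).im * ‖u z‖ ^ 2) + lam * ‖u z‖ ^ 2 -
        s * (‖v z‖ ^ 2 * ‖u z‖ ^ 2) := by
    funext z; ring
  have i1 := (integrable_linear_mul_sq hc (continuous_im_conj_mul α) (abs_im_conj_mul_le α)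
    h1 h2).const_mul 2
  have i2 := (integrable_sq_of_memLp h1).const_mul lam
  have i12 : Integrable fun z => 2 * ((conj α * z).im * ‖u z‖ ^ 2) + lam * ‖u z‖ ^ 2 := i1.add i2
  have i3 := h3.const_mul s
  rw [e]
  refine ⟨i12.sub i3, ?_⟩
  rw [integral_sub i12 i3, integral_add i1 i2]
  simp only [integral_const_mul]

/-- Polarization of the quadratic form of the symbol at U and L_θ U: the cross term vanishes by the
weak equation, so the form at U plus the form at L_θ U equals the form at U - L_θ U. -/
lemma IsProfile.rot_identity (h : IsProfile s lam α f (gaussMul g))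
    (hV : MemLp (gaussMul g) 2 (volume : Measure ℂ)) (hg : Differentiable ℂ g) (θ : ℝ) :
    2 * (∫ z, (conj α * z).im * ‖rot θ (gaussMul f) z‖ ^ 2) + 2 * momIm α (gaussMul f) +
      2 * lam * mass (gaussMul f) - s * ham (gaussMul f) (gaussMul g) -
      s * (∫ z, ‖gaussMul g z‖ ^ 2 * ‖rot θ (gaussMul f) z‖ ^ 2) =
    2 * (∫ z, (conj α * z).im * rotDiff θ (gaussMul f) z) +
      lam * (∫ z, rotDiff θ (gaussMul f) z) -
      s * ∫ z, ‖gaussMul g z‖ ^ 2 * rotDiff θ (gaussMul f) z := by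
  obtain ⟨C, hC0, hC⟩ := exists_norm_gaussMul_le h.diff h.memLp
  have hgc := continuous_gaussMul hg
  have hfc := h.cont
  have hrc := continuous_rot θ hfc
  have hc := continuous_im_conj_mul α
  have hrC : ∀ z, ‖rot θ (gaussMul f) z‖ ≤ C := fun z => hC _
  have hdC : ∀ z, ‖gaussMul f z - rot θ (gaussMul f) z‖ ≤ C + C := fun z =>
    (norm_sub_le _ _).trans (add_le_add (hC z) (hrC z))
  obtain ⟨i1, e1⟩ := integral_symbol_mul_sq s lam α (v := gaussMul g) hfc h.memLp h.memLp_mul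
    (h.integrable_quartic hg)
  obtain ⟨i2, e2⟩ := integral_symbol_mul_sq s lam α (v := gaussMul g) hrc (memLp_rot θ h.memLp)
    (memLp_mul_rot θ h.memLp_mul) (integrable_bdd_mul_sq hrc hgc hrC hV)
  obtain ⟨i3, e3⟩ := integral_symbol_mul_sq s lam α (v := gaussMul g)
    (u := fun z => gaussMul f z - rot θ (gaussMul f) z) (hfc.sub hrc) (h.memLp_sub_rot θ)
    (h.memLp_mul_sub_rot θ) (integrable_bdd_mul_sq (hfc.sub hrc) hgc hdC hV)
  have hw := h.weak _ (differentiable_comp_rot θ h.diff) (by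
    rw [← rot_gaussMul]; exact memLp_rot θ h.memLp)
  rw [← rot_gaussMul] at hw
  have hi : Integrable fun z => ((2 * (conj α * z).im + lam - s * ‖gaussMul g z‖ ^ 2 : ℝ) : ℂ) *
      (gaussMul f z * conj (rot θ (gaussMul f) z)) := by
    refine (i1.norm.add i2.norm).mono' (by fun_prop) (ae_of_all _ fun z => ?_)
    simp only [norm_mul, RCLike.norm_conj, Complex.norm_real, Pi.add_apply, norm_pow, norm_norm]
    rw [← mul_add]
    refine mul_le_mul_of_nonneg_left ?_ (norm_nonneg _)
    nlinarith [sq_nonneg (‖gaussMul f z‖ - ‖rot θ (gaussMul f) z‖),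
      sq_nonneg (‖gaussMul f z‖), sq_nonneg (‖rot θ (gaussMul f) z‖)]
  have hre := reCLM.integral_comp_comm hi
  simp only [reCLM_apply] at hre
  rw [hw, zero_re] at hre
  have hpt : ∀ z, 2 * (((2 * (conj α * z).im + lam - s * ‖gaussMul g z‖ ^ 2 : ℝ) : ℂ) *
      (gaussMul f z * conj (rot θ (gaussMul f) z))).re =
      (2 * (conj α * z).im + lam - s * ‖gaussMul g z‖ ^ 2) * ‖gaussMul f z‖ ^ 2 +
      (2 * (conj α * z).im + lam - s * ‖gaussMul g z‖ ^ 2) * ‖rot θ (gaussMul f) z‖ ^ 2 -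
      (2 * (conj α * z).im + lam - s * ‖gaussMul g z‖ ^ 2) *
        ‖gaussMul f z - rot θ (gaussMul f) z‖ ^ 2 := by
    intro z
    rw [re_ofReal_mul]
    simp only [Complex.sq_norm, normSq_sub]
    ring
  have hz : ∫ z, 2 * (((2 * (conj α * z).im + lam - s * ‖gaussMul g z‖ ^ 2 : ℝ) : ℂ) *
      (gaussMul f z * conj (rot θ (gaussMul f) z))).re = 0 := by
    rw [integral_const_mul, hre, mul_zero]
  simp_rw [hpt] at hz
  rw [integral_sub (i1.fun_add i2) i3, integral_add i1 i2, e1, e2, e3] at hz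
  have hr : ∫ z, ‖rot θ (gaussMul f) z‖ ^ 2 = mass (gaussMul f) :=
    integral_comp_rot θ fun z => ‖gaussMul f z‖ ^ 2
  have hh : ham (gaussMul f) (gaussMul g) = ∫ z, ‖gaussMul g z‖ ^ 2 * ‖gaussMul f z‖ ^ 2 := by
    unfold ham
    simp_rw [mul_comm]
  rw [hr] at hz
  rw [hh]
  unfold momIm rotDiff
  unfold mass at hz ⊢
  linarith

/-- The plane is cut at radius R. Inside, the increment is at most C|z||θ|; outside, |z| ≤ |z|²/R
and the L² bound on zU takes over. -/
lemma integral_norm_mul_rotDiff_le (h : IsProfile s lam α f (gaussMul g)) {C : ℝ}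
    (hC0 : 0 ≤ C) (hC : ∀ z, ‖gaussMul (deriv f) z‖ ≤ C) {R : ℝ} (hR : 1 ≤ R) {θ : ℝ}
    (hθ : |θ| ≤ (R ^ 3)⁻¹) :
    ∫ z, ‖z‖ * rotDiff θ (gaussMul f) z ≤
      (C ^ 2 * Real.pi + 4 * ∫ z, ‖z * gaussMul f z‖ ^ 2) / R := by
  have hR0 : 0 < R := by linarith
  have iN := integrable_sq_of_memLp h.memLp_mul
  have iNr := integrable_sq_of_memLp (memLp_mul_rot θ h.memLp_mul)
  have hNr : ∫ z, ‖z * rot θ (gaussMul f) z‖ ^ 2 = ∫ z, ‖z * gaussMul f z‖ ^ 2 := by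
    rw [← integral_comp_rot θ fun z => ‖z * gaussMul f z‖ ^ 2]
    congr 1
    funext z
    simp only [norm_mul, norm_exp_I_mul_ofReal, one_mul]
    rfl
  have iB : Integrable ((Metric.closedBall (0 : ℂ) R).indicator fun _ => C ^ 2 / R ^ 3) :=
    (integrable_indicator_iff Metric.isClosed_closedBall.measurableSet).2
      (integrableOn_const (measure_closedBall_lt_top.ne))
  have iD : Integrable fun z => ‖z‖ * rotDiff θ (gaussMul f) z :=
    integrable_linear_mul_sq (h.cont.sub (continuous_rot θ h.cont)) continuous_norm (A := 1)
      (fun z => by simp) (h.memLp_sub_rot θ) (h.memLp_mul_sub_rot θ)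
  have hpt : ∀ z, ‖z‖ * rotDiff θ (gaussMul f) z ≤
      (Metric.closedBall (0 : ℂ) R).indicator (fun _ => C ^ 2 / R ^ 3) z +
        2 / R * (‖z * gaussMul f z‖ ^ 2 + ‖z * rot θ (gaussMul f) z‖ ^ 2) := by
    intro z
    by_cases hz : ‖z‖ ≤ R
    · rw [Set.indicator_of_mem (mem_closedBall_zero_iff.2 hz)]
      refine le_add_of_le_of_nonneg ?_ (by positivity)
      have h1 := norm_gaussMul_sub_rot_le h.diff hC θ z
      unfold rotDiff
      -- The cube in |θ| ≤ R⁻³ makes this C²/R³, which still gives C²π/R after multiplication by the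
      -- area πR².
      calc _ ≤ R * (C * R * (R ^ 3)⁻¹) ^ 2 := by
            gcongr
            exact h1.trans (by gcongr)
        _ = C ^ 2 / R ^ 3 := by field_simp
    · rw [Set.indicator_of_notMem (by simpa using hz), zero_add]
      push Not at hz
      have h1 := rotDiff_le θ (gaussMul f) z
      rw [norm_mul, norm_mul, mul_pow, mul_pow, ← mul_add]
      calc _ ≤ ‖z‖ * (2 * (‖gaussMul f z‖ ^ 2 + ‖rot θ (gaussMul f) z‖ ^ 2)) := by gcongr
        _ ≤ (‖z‖ * (‖z‖ / R)) * (2 * (‖gaussMul f z‖ ^ 2 + ‖rot θ (gaussMul f) z‖ ^ 2)) := by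
            gcongr
            exact le_mul_of_one_le_right (norm_nonneg _) ((one_le_div hR0).2 hz.le)
        _ = _ := by ring
  have iS := (iN.add iNr).const_mul (2 / R)
  refine (integral_mono iD (iB.add iS) hpt).trans (le_of_eq ?_)
  rw [integral_add' iB iS, integral_const_mul, integral_add' iN iNr, hNr,
    integral_indicator Metric.isClosed_closedBall.measurableSet, setIntegral_const, Measure.real,
    Complex.volume_closedBall]
  simp only [ENNReal.toReal_mul, ENNReal.toReal_pow, ENNReal.toReal_ofReal hR0.le, smul_eq_mul,
    ENNReal.coe_toReal, NNReal.coe_real_pi]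
  field_simp
  ring

/-- The identities at θ and -θ are subtracted, so only terms odd in θ survive on the left. The
quadratic errors are θ·O(1/R): the linear weight gains a factor θ from the difference of the two
rotations, and the quartic error is O(θ²) because zV ∈ L². -/
lemma IsProfile.rot_estimate (h : IsProfile s lam α f (gaussMul g))
    (hVz : MemLp (fun z => z * gaussMul g z) 2 (volume : Measure ℂ))
    (hV : MemLp (gaussMul g) 2 (volume : Measure ℂ)) (hg : Differentiable ℂ g) (hs : |s| = 1)
    {C : ℝ} (hC0 : 0 ≤ C) (hC : ∀ z, ‖gaussMul (deriv f) z‖ ≤ C) {R : ℝ} (hR : 1 ≤ R) {θ : ℝ}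
    (hθ0 : 0 ≤ θ) (hθ : θ ≤ (R ^ 3)⁻¹) :
    |4 * Real.sin θ * momRe α (gaussMul f) +
      s * ((∫ z, ‖gaussMul g z‖ ^ 2 * ‖rot θ (gaussMul f) z‖ ^ 2) -
        ∫ z, ‖gaussMul g z‖ ^ 2 * ‖rot (-θ) (gaussMul f) z‖ ^ 2)| ≤
      θ * ((2 * ‖α‖ * (C ^ 2 * Real.pi + 4 * ∫ z, ‖z * gaussMul f z‖ ^ 2) +
        2 * C ^ 2 * ∫ z, ‖z * gaussMul g z‖ ^ 2) / R) := by
  have hR0 : 0 < R := by linarith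
  have hgc := continuous_gaussMul hg
  have hfc := h.cont
  have r1 := h.rot_identity hV hg θ
  have r2 := h.rot_identity hV hg (-θ)
  rw [h.integral_im_rot_sq] at r1 r2
  rw [Real.cos_neg, Real.sin_neg] at r2
  have hρ : ∫ z, rotDiff (-θ) (gaussMul f) z = ∫ z, rotDiff θ (gaussMul f) z := by
    rw [← integral_comp_rot θ]
    simp_rw [rotDiff_neg]
  -- The increment at -θ is the increment at θ composed with a rotation; moving that rotation onto
  -- the weight leaves a difference of weights bounded by |α||e^{iθ} - 1||z|.
  have hyρ : ∫ z, (conj α * z).im * rotDiff (-θ) (gaussMul f) z =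
      ∫ z, (conj α * (exp (I * θ) * z)).im * rotDiff θ (gaussMul f) z := by
    rw [← integral_comp_rot θ]
    simp_rw [rotDiff_neg]
  have iy : Integrable fun z => (conj α * z).im * rotDiff θ (gaussMul f) z :=
    integrable_linear_mul_sq (hfc.sub (continuous_rot θ hfc)) (continuous_im_conj_mul α)
      (abs_im_conj_mul_le α) (h.memLp_sub_rot θ) (h.memLp_mul_sub_rot θ)
  have iy' : Integrable fun z => (conj α * (exp (I * θ) * z)).im * rotDiff θ (gaussMul f) z :=
    integrable_linear_mul_sq (hfc.sub (continuous_rot θ hfc))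
      ((continuous_im_conj_mul α).comp (continuous_const.mul continuous_id)) (A := ‖α‖)
      (fun z => (abs_im_conj_mul_le α _).trans (by
        rw [norm_mul, norm_exp_I_mul_ofReal, one_mul]))
      (h.memLp_sub_rot θ) (h.memLp_mul_sub_rot θ)
  have hdiff : |(∫ z, (conj α * z).im * rotDiff θ (gaussMul f) z) -
      ∫ z, (conj α * z).im * rotDiff (-θ) (gaussMul f) z| ≤
      ‖α‖ * θ * ((C ^ 2 * Real.pi + 4 * ∫ z, ‖z * gaussMul f z‖ ^ 2) / R) := by
    have iz : Integrable fun z => ‖z‖ * rotDiff θ (gaussMul f) z :=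
      integrable_linear_mul_sq (hfc.sub (continuous_rot θ hfc)) continuous_norm (A := 1)
        (fun z => by simp) (h.memLp_sub_rot θ) (h.memLp_mul_sub_rot θ)
    rw [hyρ, ← integral_sub iy iy', ← Real.norm_eq_abs]
    refine (norm_integral_le_of_norm_le (iz.const_mul (‖α‖ * θ)) (ae_of_all _ fun z => ?_)).trans ?_
    · rw [← sub_mul, norm_mul, ← mul_assoc (‖α‖ * θ)]
      have hn : ‖rotDiff θ (gaussMul f) z‖ = rotDiff θ (gaussMul f) z :=
        Real.norm_of_nonneg (by unfold rotDiff; positivity)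
      rw [hn]
      have hn0 : 0 ≤ rotDiff θ (gaussMul f) z := sq_nonneg _
      refine mul_le_mul_of_nonneg_right ?_ hn0
      rw [← sub_im, ← mul_sub, Real.norm_eq_abs]
      refine (abs_im_conj_mul_le α _).trans ?_
      have : z - exp (I * θ) * z = -((exp (I * θ) - 1) * z) := by ring
      rw [this, norm_neg, norm_mul, ← mul_assoc]
      have h1 := norm_exp_I_mul_sub_one_le θ
      rw [abs_of_nonneg hθ0] at h1
      gcongr
    · rw [integral_const_mul]
      exact mul_le_mul_of_nonneg_left (integral_norm_mul_rotDiff_le h hC0 hC hR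
        (by rwa [abs_of_nonneg hθ0])) (by positivity)
  have hq : ∀ t : ℝ, |t| = θ → |∫ z, ‖gaussMul g z‖ ^ 2 * rotDiff t (gaussMul f) z| ≤
      C ^ 2 * θ ^ 2 * ∫ z, ‖z * gaussMul g z‖ ^ 2 := by
    intro t ht
    rw [← Real.norm_eq_abs, ← integral_const_mul]
    refine norm_integral_le_of_norm_le ((integrable_sq_of_memLp hVz).const_mul _)
      (ae_of_all _ fun z => ?_)
    have h1 := norm_gaussMul_sub_rot_le h.diff hC t z
    rw [ht] at h1
    unfold rotDiff
    rw [Real.norm_of_nonneg (by positivity), norm_mul]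
    calc _ ≤ ‖gaussMul g z‖ ^ 2 * (C * ‖z‖ * θ) ^ 2 := by gcongr
      _ = _ := by ring
  have hq1 := abs_le.1 (hq θ (abs_of_nonneg hθ0))
  have hq2 := abs_le.1 (hq (-θ) (by rw [abs_neg, abs_of_nonneg hθ0]))
  have hd := abs_le.1 hdiff
  have hθR : θ ≤ 1 / R := by
    refine hθ.trans ?_
    rw [one_div]
    exact inv_anti₀ hR0 (le_self_pow₀ hR (by norm_num))
  have hN : 0 ≤ C ^ 2 * ∫ z, ‖z * gaussMul g z‖ ^ 2 :=
    mul_nonneg (by positivity) (integral_nonneg fun z => by positivity)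
  have hθ2 : C ^ 2 * θ ^ 2 * (∫ z, ‖z * gaussMul g z‖ ^ 2) ≤
      θ * ((C ^ 2 * ∫ z, ‖z * gaussMul g z‖ ^ 2) / R) := by
    calc _ = (θ * θ) * (C ^ 2 * ∫ z, ‖z * gaussMul g z‖ ^ 2) := by ring
      _ ≤ (θ * (1 / R)) * (C ^ 2 * ∫ z, ‖z * gaussMul g z‖ ^ 2) := by gcongr
      _ = _ := by ring
  have hfin : θ * ((2 * ‖α‖ * (C ^ 2 * Real.pi + 4 * ∫ z, ‖z * gaussMul f z‖ ^ 2) +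
        2 * C ^ 2 * ∫ z, ‖z * gaussMul g z‖ ^ 2) / R) =
      2 * (‖α‖ * θ * ((C ^ 2 * Real.pi + 4 * ∫ z, ‖z * gaussMul f z‖ ^ 2) / R)) +
      2 * (θ * ((C ^ 2 * ∫ z, ‖z * gaussMul g z‖ ^ 2) / R)) := by ring
  rw [hfin]
  rw [hρ] at r2
  have hs' : s = 1 ∨ s = -1 := by
    rcases abs_eq (zero_le_one) |>.1 hs with h | h
    · exact Or.inl h
    · exact Or.inr h
  rcases hs' with rfl | rfl
  · rw [abs_le]
    constructor <;> linarith
  · rw [abs_le]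
    constructor <;> linarith

end Rot

/-- The odd quartic terms of U and V coincide: rotating V by θ is the same as rotating U by -θ, and
the sign change is undone by the opposite signs in the equations. Subtracting leaves 4 sin θ times
the difference of moments; with θ = R⁻³, division by θ and R → ∞ finish. -/
lemma momRe_eq_of_isProfile {lam mu : ℝ} {α : ℂ} {f g : ℂ → ℂ}
    (hU : IsProfile 1 lam α f (gaussMul g)) (hV : IsProfile (-1) mu α g (gaussMul f)) :
    momRe α (gaussMul f) = momRe α (gaussMul g) := by
  have hdf : Differentiable ℂ (deriv f) := (hU.diff.contDiff (n := 2)).differentiable_deriv_two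
  have hdg : Differentiable ℂ (deriv g) := (hV.diff.contDiff (n := 2)).differentiable_deriv_two
  obtain ⟨C, hC0, hC⟩ := exists_norm_gaussMul_le hdf hU.memLp_deriv
  obtain ⟨C', hC0', hC'⟩ := exists_norm_gaussMul_le hdg hV.memLp_deriv
  set K := 2 * ‖α‖ * (C ^ 2 * Real.pi + 4 * ∫ z, ‖z * gaussMul f z‖ ^ 2) +
        2 * C ^ 2 * ∫ z, ‖z * gaussMul g z‖ ^ 2 with hK
  set K' := 2 * ‖α‖ * (C' ^ 2 * Real.pi + 4 * ∫ z, ‖z * gaussMul g z‖ ^ 2) +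
        2 * C' ^ 2 * ∫ z, ‖z * gaussMul f z‖ ^ 2 with hK'
  have key : ∀ R : ℝ, 1 ≤ R → |momRe α (gaussMul f) - momRe α (gaussMul g)| ≤ (K + K') / R := by
    intro R hR
    have hR0 : 0 < R := by linarith
    set θ := (R ^ 3)⁻¹
    have hθ0 : 0 < θ := by positivity
    have hθ1 : θ ≤ 1 := inv_le_one_of_one_le₀ (one_le_pow₀ hR)
    have e1 := hU.rot_estimate hV.memLp_mul hV.memLp hV.diff (by simp) hC0 hC hR hθ0.le le_rfl
    have e2 := hV.rot_estimate hU.memLp_mul hU.memLp hU.diff (by simp) hC0' hC' hR hθ0.le le_rfl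
    have hsw : ∀ t : ℝ, ∫ z, ‖gaussMul f z‖ ^ 2 * ‖rot t (gaussMul g) z‖ ^ 2 =
        ∫ z, ‖gaussMul g z‖ ^ 2 * ‖rot (-t) (gaussMul f) z‖ ^ 2 := by
      intro t
      rw [← integral_comp_rot t fun z => ‖gaussMul g z‖ ^ 2 * ‖rot (-t) (gaussMul f) z‖ ^ 2]
      congr 1
      funext z
      rw [rot_neg_rot, mul_comm]
      rfl
    rw [hsw, hsw, neg_neg] at e2
    rw [← hK] at e1
    rw [← hK'] at e2
    have hsin : θ / 2 ≤ Real.sin θ := by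
      have h1 := Real.sin_gt_sub_cube hθ0
      have h2 : θ ^ 3 ≤ θ := pow_le_of_le_one hθ0.le hθ1 (by norm_num)
      linarith
    have hsub : |4 * Real.sin θ * (momRe α (gaussMul f) - momRe α (gaussMul g))| ≤
        θ * ((K + K') / R) := by
      have := abs_sub _ _ |>.trans (add_le_add e1 e2)
      refine le_trans (le_of_eq ?_) (this.trans (le_of_eq ?_))
      · congr 1
        ring
      · ring
    rw [abs_mul, abs_of_nonneg (by linarith)] at hsub
    have h2 : θ * |momRe α (gaussMul f) - momRe α (gaussMul g)| ≤ θ * ((K + K') / R) := by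
      refine le_trans (mul_le_mul_of_nonneg_right ?_ (abs_nonneg _)) hsub
      linarith
    exact le_of_mul_le_mul_left h2 hθ0
  have hlim : Tendsto (fun R : ℝ => (K + K') / R) atTop (𝓝 0) := tendsto_const_nhds.div_atTop tendsto_id
  have h0 := ge_of_tendsto hlim ((eventually_ge_atTop 1).mono key)
  have := abs_nonpos_iff.1 h0
  linarith

/-! ### The bound on the speed -/

/-- Cauchy's formula for the first derivative on the circle of radius r. -/
lemma norm_deriv_zero_le_integral {k : ℂ → ℂ} (hk : Differentiable ℂ k) {r : ℝ} (hr : 0 < r) :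
    2 * Real.pi * r * ‖deriv k 0‖ ≤
      ∫ θ in (-Real.pi)..Real.pi, ‖k (circleMap 0 r θ)‖ := by
  have hper : Function.Periodic (fun θ => ‖k (circleMap 0 r θ)‖) (2 * Real.pi) := fun θ => by
    simp only [periodic_circleMap 0 r θ]
  have h1 := hper.intervalIntegral_add_eq 0 (-Real.pi)
  rw [zero_add, show -Real.pi + 2 * Real.pi = Real.pi by ring] at h1
  rw [← h1]
  have h2 := two_pi_I_inv_smul_circleIntegral_sub_sq_inv_smul_of_differentiable isOpen_univ
    (Set.subset_univ (Metric.closedBall (0 : ℂ) r)) hk.differentiableOn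
    (Metric.mem_ball_self hr)
  rw [← h2, norm_smul, norm_inv, norm_mul, norm_mul, norm_I, mul_one, norm_real,
    Real.norm_of_nonneg Real.pi_pos.le, RCLike.norm_ofNat]
  have h3 : ‖∮ z in C(0, r), ((z - 0) ^ 2)⁻¹ • k z‖ ≤
      ∫ θ in (0)..(2 * Real.pi), r⁻¹ * ‖k (circleMap 0 r θ)‖ := by
    refine (intervalIntegral.norm_integral_le_integral_norm Real.two_pi_pos.le).trans
      (le_of_eq ?_)
    congr 1
    funext θ
    rw [deriv_circleMap, norm_smul, norm_smul, norm_inv, norm_pow, norm_mul, norm_I, mul_one,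
      sub_zero, norm_circleMap_zero, abs_of_pos hr, ← mul_assoc]
    congr 1
    field_simp
  rw [intervalIntegral.integral_const_mul] at h3
  calc _ = r * ‖∮ z in C(0, r), ((z - 0) ^ 2)⁻¹ • k z‖ := by
        have := Real.pi_pos
        field_simp
    _ ≤ r * (r⁻¹ * ∫ θ in (0)..(2 * Real.pi), ‖k (circleMap 0 r θ)‖) := by gcongr
    _ = _ := by field_simp

lemma integral_sq_mul_exp : ∫ r in Set.Ioi (0 : ℝ), r ^ 2 * Real.exp (-2 * r ^ 2) =
    Real.sqrt Real.pi / (8 * Real.sqrt 2) := by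
  have h := _root_.integral_rpow_mul_exp_neg_mul_rpow (p := 2) (q := 2) (b := 2) (by norm_num)
    (by norm_num) (by norm_num)
  simp only [Real.rpow_two] at h
  rw [h, show ((2 : ℝ) + 1) / 2 = 1 / 2 + 1 by norm_num, Real.Gamma_add_one (by norm_num),
    Real.Gamma_one_half_eq, show -((2 : ℝ) + 1) / 2 = -(1 + 1 / 2) by norm_num,
    Real.rpow_neg (by norm_num), Real.rpow_add (by norm_num), Real.rpow_one, ← Real.sqrt_eq_rpow]
  field_simp
  norm_num

/-- The circle bound is integrated against r e^{-2r²} dr in polar coordinates. Lower integrals avoid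
any integrability requirement on k. -/
lemma norm_deriv_zero_le_lintegral {k : ℂ → ℂ} (hk : Differentiable ℂ k) :
    ENNReal.ofReal (2 * Real.pi * (Real.sqrt Real.pi / (8 * Real.sqrt 2)) * ‖deriv k 0‖) ≤
      ∫⁻ w, ENNReal.ofReal (Real.exp (-2 * ‖w‖ ^ 2) * ‖k w‖) := by
  have hkc := hk.continuous
  have hm : Measurable fun p : ℝ × ℝ => ENNReal.ofReal p.1 •
      ENNReal.ofReal (Real.exp (-2 * ‖Complex.polarCoord.symm p‖ ^ 2) *
        ‖k (Complex.polarCoord.symm p)‖) := by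
    have e : (fun p : ℝ × ℝ => (Complex.polarCoord.symm p : ℂ)) = fun p : ℝ × ℝ =>
        (p.1 : ℂ) * ((Real.cos p.2 : ℂ) + (Real.sin p.2 : ℂ) * I) :=
      funext Complex.polarCoord_symm_apply
    have hc : Continuous fun p : ℝ × ℝ => (Complex.polarCoord.symm p : ℂ) := by
      rw [e]
      have h1 := Real.continuous_cos
      have h2 := Real.continuous_sin
      fun_prop
    have h3 : Continuous fun p : ℝ × ℝ => Real.exp (-2 * ‖Complex.polarCoord.symm p‖ ^ 2) *
        ‖k (Complex.polarCoord.symm p)‖ := by fun_prop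
    simp only [smul_eq_mul]
    exact measurable_fst.ennreal_ofReal.mul h3.measurable.ennreal_ofReal
  rw [← Complex.lintegral_comp_polarCoord_symm, polarCoord_target, Measure.volume_eq_prod,
    setLIntegral_prod _ hm.aemeasurable]
  -- A non-integrable function would have integral 0, contradicting the positive value already
  -- computed.
  have hint : IntegrableOn (fun r : ℝ => r ^ 2 * Real.exp (-2 * r ^ 2)) (Set.Ioi 0) := by
    by_contra hc
    have h0 := integral_sq_mul_exp
    rw [integral_undef hc] at h0
    have : 0 < Real.sqrt Real.pi / (8 * Real.sqrt 2) := by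
      have := Real.pi_pos
      positivity
    linarith
  have hl : ENNReal.ofReal (2 * Real.pi * (Real.sqrt Real.pi / (8 * Real.sqrt 2)) * ‖deriv k 0‖) =
      ∫⁻ r in Set.Ioi (0 : ℝ), ENNReal.ofReal
        ((2 * Real.pi * ‖deriv k 0‖) * (r ^ 2 * Real.exp (-2 * r ^ 2))) := by
    rw [← ofReal_integral_eq_lintegral_ofReal (hint.const_mul _)
      (ae_of_all _ fun r => by have := Real.pi_pos; positivity), integral_const_mul,
      integral_sq_mul_exp]
    congr 1
    ring
  rw [hl]
  refine setLIntegral_mono' measurableSet_Ioi fun r hr => ?_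
  have hr : 0 < r := hr
  have e : ∀ θ : ℝ, (Complex.polarCoord.symm (r, θ) : ℂ) = circleMap 0 r θ := fun θ => by
    simp [circleMap, Complex.exp_mul_I]
  have hcc : Continuous fun θ => r * Real.exp (-2 * r ^ 2) * ‖k (circleMap 0 r θ)‖ := by
    have := continuous_circleMap 0 r
    fun_prop
  have h1 : ∫⁻ θ in Set.Ioo (-Real.pi) Real.pi, ENNReal.ofReal r •
      ENNReal.ofReal (Real.exp (-2 * ‖Complex.polarCoord.symm (r, θ)‖ ^ 2) *
        ‖k (Complex.polarCoord.symm (r, θ))‖) =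
      ENNReal.ofReal (∫ θ in (-Real.pi)..Real.pi,
        r * Real.exp (-2 * r ^ 2) * ‖k (circleMap 0 r θ)‖) := by
    rw [intervalIntegral.integral_of_le (by linarith [Real.pi_pos]),
      integral_Ioc_eq_integral_Ioo, ofReal_integral_eq_lintegral_ofReal
      ((hcc.integrableOn_Icc).mono_set Set.Ioo_subset_Icc_self)
      (ae_of_all _ fun θ => by positivity)]
    congr 1
    funext θ
    rw [e, norm_circleMap_zero, abs_of_pos hr, smul_eq_mul, ← ENNReal.ofReal_mul hr.le, mul_assoc]
  rw [h1, intervalIntegral.integral_const_mul]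
  refine ENNReal.ofReal_le_ofReal ?_
  have h2 := norm_deriv_zero_le_integral hk hr
  calc _ = r * Real.exp (-2 * r ^ 2) * (2 * Real.pi * r * ‖deriv k 0‖) := by ring
    _ ≤ _ := by gcongr

lemma norm_gaussMul_sq (k : ℂ → ℂ) (w : ℂ) :
    ‖gaussMul k w‖ ^ 2 = Real.exp (-‖w‖ ^ 2) * ‖k w‖ ^ 2 := by
  unfold gaussMul
  rw [norm_mul, norm_real, Real.norm_of_nonneg (Real.exp_pos _).le, mul_pow, ← Real.exp_nat_mul]
  congr 2
  push_cast
  ring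

/-- The derivative of k(w) = (f(z+w)g(z-w))² at 0 is 2fg(gf' - fg'). The weight e^{-2|w|²} is chosen
so that, by the parallelogram law, its product with e^{-2|z|²} splits into the Gaussians at z + w
and z - w. -/
lemma wronskian_pointwise {f g : ℂ → ℂ} (hf : Differentiable ℂ f) (hg : Differentiable ℂ g)
    (z : ℂ) :
    ENNReal.ofReal (4 * Real.pi * (Real.sqrt Real.pi / (8 * Real.sqrt 2)) *
      ‖gaussMul f z * gaussMul g z * conj (gaussMul g z * gaussMul (deriv f) z -
        gaussMul f z * gaussMul (deriv g) z)‖) ≤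
      ∫⁻ w, ENNReal.ofReal (‖gaussMul f (z + w)‖ ^ 2 * ‖gaussMul g (z - w)‖ ^ 2) := by
  set k : ℂ → ℂ := fun w => (f (z + w) * g (z - w)) ^ 2
  have hfz : Differentiable ℂ fun w => f (z + w) := hf.comp (differentiable_id.const_add z)
  have hgz : Differentiable ℂ fun w => g (z - w) := hg.comp (differentiable_id.const_sub z)
  have hk : Differentiable ℂ k := (hfz.mul hgz).pow 2
  have hd : deriv k 0 = 2 * (f z * g z) * (g z * deriv f z - f z * deriv g z) := by
    have h1 : HasDerivAt (fun w => f (z + w)) (deriv f z) 0 := by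
      have := (hf (z + 0)).hasDerivAt.comp_const_add z 0
      simpa using this
    have h2 : HasDerivAt (fun w => g (z - w)) (-deriv g z) 0 := by
      have := (hg (z - 0)).hasDerivAt.comp_const_sub z 0
      simpa using this
    have h3 := ((h1.fun_mul h2).fun_pow 2).deriv
    rw [h3]
    simp only [add_zero, sub_zero, Nat.cast_ofNat, Nat.add_one_sub_one, pow_one]
    ring
  have h := norm_deriv_zero_le_lintegral hk
  have e1 : ∀ w, Real.exp (-2 * ‖z‖ ^ 2) * (Real.exp (-2 * ‖w‖ ^ 2) * ‖k w‖) =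
      ‖gaussMul f (z + w)‖ ^ 2 * ‖gaussMul g (z - w)‖ ^ 2 := by
    intro w
    rw [norm_gaussMul_sq, norm_gaussMul_sq, norm_pow, norm_mul, mul_pow, ← mul_assoc,
      ← Real.exp_add]
    have : -2 * ‖z‖ ^ 2 + -2 * ‖w‖ ^ 2 = -‖z + w‖ ^ 2 + -‖z - w‖ ^ 2 := by
      have := parallelogram_law_with_norm ℝ z w
      nlinarith
    rw [this, Real.exp_add]
    ring
  have e2 : ‖gaussMul f z * gaussMul g z * conj (gaussMul g z * gaussMul (deriv f) z -
        gaussMul f z * gaussMul (deriv g) z)‖ =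
      Real.exp (-2 * ‖z‖ ^ 2) * (‖deriv k 0‖ / 2) := by
    have : gaussMul g z * gaussMul (deriv f) z - gaussMul f z * gaussMul (deriv g) z =
        (Real.exp (-‖z‖ ^ 2 / 2) : ℂ) ^ 2 * (g z * deriv f z - f z * deriv g z) := by
      unfold gaussMul
      ring
    rw [this, hd]
    unfold gaussMul
    simp only [norm_mul, RCLike.norm_conj, norm_pow, norm_real,
      Real.norm_of_nonneg (Real.exp_pos _).le, RCLike.norm_ofNat]
    have hE : Real.exp (-2 * ‖z‖ ^ 2) = Real.exp (-‖z‖ ^ 2 / 2) ^ 4 := by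
      rw [← Real.exp_nat_mul]
      congr 1
      push_cast
      ring
    rw [hE]
    ring
  calc _ = ENNReal.ofReal (Real.exp (-2 * ‖z‖ ^ 2)) * ENNReal.ofReal
        (2 * Real.pi * (Real.sqrt Real.pi / (8 * Real.sqrt 2)) * ‖deriv k 0‖) := by
        rw [e2, ← ENNReal.ofReal_mul (Real.exp_pos _).le]
        congr 1
        ring
    _ ≤ ENNReal.ofReal (Real.exp (-2 * ‖z‖ ^ 2)) *
        ∫⁻ w, ENNReal.ofReal (Real.exp (-2 * ‖w‖ ^ 2) * ‖k w‖) := by gcongr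
    _ = _ := by
        rw [← lintegral_const_mul' _ _ ENNReal.ofReal_ne_top]
        congr 1
        funext w
        rw [← ENNReal.ofReal_mul (Real.exp_pos _).le, e1]

lemma lintegral_comp_two_mul {F : ℂ → ENNReal} (hF : Measurable F) :
    ∫⁻ z, F (2 * z) = ENNReal.ofReal (1 / 4) * ∫⁻ z, F z := by
  have h := Measure.map_addHaar_smul (volume : Measure ℂ) (r := 2) two_ne_zero
  have h2 : ∫⁻ z, F z ∂(Measure.map (fun z : ℂ => (2 : ℝ) • z) volume) = ∫⁻ z, F (2 * z) := by
    rw [lintegral_map hF (measurable_const_smul (2 : ℝ))]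
    simp
  rw [← h2, h, lintegral_smul_measure, Complex.finrank_real_complex, smul_eq_mul]
  norm_num

/-- Change of variables (z, w) ↦ (z + w, z - w), done one variable at a time; the factor 1/4 comes
from z ↦ 2z in real dimension two. -/
lemma lintegral_lintegral_gaussMul {f g : ℂ → ℂ} (hf : Differentiable ℂ f)
    (hg : Differentiable ℂ g) :
    ∫⁻ z, ∫⁻ w, ENNReal.ofReal (‖gaussMul f (z + w)‖ ^ 2 * ‖gaussMul g (z - w)‖ ^ 2) =
      ENNReal.ofReal (1 / 4) * ((∫⁻ z, ENNReal.ofReal (‖gaussMul f z‖ ^ 2)) *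
        ∫⁻ z, ENNReal.ofReal (‖gaussMul g z‖ ^ 2)) := by
  have hfc := continuous_gaussMul hf
  have hgc := continuous_gaussMul hg
  have h1 : ∀ z : ℂ,
      ∫⁻ w, ENNReal.ofReal (‖gaussMul f (z + w)‖ ^ 2 * ‖gaussMul g (z - w)‖ ^ 2) =
      ∫⁻ a, ENNReal.ofReal (‖gaussMul f a‖ ^ 2 * ‖gaussMul g (2 * z - a)‖ ^ 2) := by
    intro z
    rw [← lintegral_add_left_eq_self
      (fun a => ENNReal.ofReal (‖gaussMul f a‖ ^ 2 * ‖gaussMul g (2 * z - a)‖ ^ 2)) z]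
    congr 1
    funext w
    rw [show 2 * z - (z + w) = z - w by ring]
  simp_rw [h1]
  rw [lintegral_lintegral_swap]
  · have h2 : ∀ a : ℂ,
        ∫⁻ z, ENNReal.ofReal (‖gaussMul f a‖ ^ 2 * ‖gaussMul g (2 * z - a)‖ ^ 2) =
        ENNReal.ofReal (‖gaussMul f a‖ ^ 2) *
          (ENNReal.ofReal (1 / 4) * ∫⁻ z, ENNReal.ofReal (‖gaussMul g z‖ ^ 2)) := by
      intro a
      have hm : Measurable fun z => ENNReal.ofReal (‖gaussMul g (z - a)‖ ^ 2) :=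
        (((hgc.comp (continuous_id.sub continuous_const)).norm.pow 2).measurable).ennreal_ofReal
      rw [← lintegral_sub_right_eq_self (fun z => ENNReal.ofReal (‖gaussMul g z‖ ^ 2)) a,
        ← lintegral_comp_two_mul hm, ← lintegral_const_mul' _ _ ENNReal.ofReal_ne_top]
      congr 1
      funext z
      rw [ENNReal.ofReal_mul (by positivity)]
    simp_rw [h2]
    have hm : Measurable fun a => ENNReal.ofReal (‖gaussMul f a‖ ^ 2) :=
      (hfc.norm.pow 2).measurable.ennreal_ofReal
    rw [lintegral_mul_const _ hm]
    ring
  · have : Continuous fun p : ℂ × ℂ => ‖gaussMul f p.2‖ ^ 2 * ‖gaussMul g (2 * p.1 - p.2)‖ ^ 2 := by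
      fun_prop
    exact this.measurable.ennreal_ofReal.aemeasurable

lemma norm_integral_wronskian_le {f g : ℂ → ℂ} (hf : Differentiable ℂ f)
    (hg : Differentiable ℂ g) (hfi : Integrable fun z => ‖gaussMul f z‖ ^ 2)
    (hgi : Integrable fun z => ‖gaussMul g z‖ ^ 2) :
    4 * Real.pi * (Real.sqrt Real.pi / (8 * Real.sqrt 2)) *
      ‖∫ z, gaussMul f z * gaussMul g z * conj (gaussMul g z * gaussMul (deriv f) z -
        gaussMul f z * gaussMul (deriv g) z)‖ ≤ 1 / 4 * (mass (gaussMul f) * mass (gaussMul g)) := by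
  have hc : 0 ≤ 4 * Real.pi * (Real.sqrt Real.pi / (8 * Real.sqrt 2)) := by
    have := Real.pi_pos
    positivity
  have hm0 : 0 ≤ mass (gaussMul f) := integral_nonneg fun z => by positivity
  have hn0 : 0 ≤ mass (gaussMul g) := integral_nonneg fun z => by positivity
  rw [← ENNReal.ofReal_le_ofReal_iff (by positivity), ENNReal.ofReal_mul hc]
  have h1 := enorm_integral_le_lintegral_enorm (μ := (volume : Measure ℂ))
    fun z => gaussMul f z * gaussMul g z * conj (gaussMul g z * gaussMul (deriv f) z -
        gaussMul f z * gaussMul (deriv g) z)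
  rw [← ofReal_norm] at h1
  refine (mul_le_mul_right h1 _).trans ?_
  rw [← lintegral_const_mul' _ _ ENNReal.ofReal_ne_top]
  refine (lintegral_mono fun z => ?_).trans (le_of_eq ((lintegral_lintegral_gaussMul hf hg).trans ?_))
  · rw [← ofReal_norm, ← ENNReal.ofReal_mul hc]
    exact wronskian_pointwise hf hg z
  · rw [← ofReal_integral_eq_lintegral_ofReal hfi (ae_of_all _ fun z => by positivity),
      ← ofReal_integral_eq_lintegral_ofReal hgi (ae_of_all _ fun z => by positivity),
      ENNReal.ofReal_mul (by norm_num), ENNReal.ofReal_mul hm0]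
    rfl

/-- In the difference of the two speed identities the terms z|U|²|V|² cancel, leaving exactly the
Wronskian integral. -/
lemma norm_speed_le_of_isProfile {lam mu : ℝ} {α : ℂ} (hα : α ≠ 0) {f g : ℂ → ℂ}
    (hU : IsProfile 1 lam α f (gaussMul g)) (hV : IsProfile (-1) mu α g (gaussMul f))
    (hne : mass (gaussMul f) ≠ 0) :
    ‖α‖ ≤ mass (gaussMul f) / (2 * Real.sqrt 2 * Real.pi) := by
  have h1 := hU.speed_identity hV.diff
  have h2 := hV.speed_identity hU.diff
  have hM := mass_eq_of_isProfile hα hU hV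
  have i1 := hU.integrable_sq_mul_dbar
  have i2 := hV.integrable_sq_mul_dbar
  have hw := norm_integral_wronskian_le hU.diff hV.diff hU.integrable_sq hV.integrable_sq
  have e : ∫ z, gaussMul f z * gaussMul g z * conj (gaussMul g z * gaussMul (deriv f) z -
        gaussMul f z * gaussMul (deriv g) z) = -(2 * I * α * mass (gaussMul f)) := by
    have h3 := integral_sub i1 i2
    have h4 : ∀ z, (‖gaussMul g z‖ ^ 2 : ℂ) *
        dbar (fun w => gaussMul f w * conj (gaussMul f w)) z -
        (‖gaussMul f z‖ ^ 2 : ℂ) * dbar (fun w => gaussMul g w * conj (gaussMul g w)) z =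
        gaussMul f z * gaussMul g z * conj (gaussMul g z * gaussMul (deriv f) z -
        gaussMul f z * gaussMul (deriv g) z) := by
      intro z
      rw [dbar_gaussMul_mul_conj hU.diff hU.diff, dbar_gaussMul_mul_conj hV.diff hV.diff,
        ← mul_conj', ← mul_conj', map_sub, map_mul, map_mul]
      ring
    simp_rw [h4] at h3
    rw [h3]
    rw [← hM] at h2
    push_cast at h1 h2
    linear_combination h1 + h2
  have hM0 : 0 < mass (gaussMul f) :=
    lt_of_le_of_ne (integral_nonneg fun z => by positivity) hne.symm
  rw [e, ← hM, norm_neg, norm_mul, norm_mul, norm_mul, norm_I, RCLike.norm_ofNat, mul_one,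
    norm_real, Real.norm_of_nonneg hM0.le] at hw
  have hpi := Real.pi_pos
  have hs2 : 0 < Real.sqrt 2 := by positivity
  -- The argument gives M/(2√2 π^{3/2}); the extra √π is simply discarded.
  have hsp : 1 ≤ Real.sqrt Real.pi := Real.one_le_sqrt.2 (by linarith [Real.pi_gt_three])
  have h5 : (‖α‖ * (Real.pi * Real.sqrt Real.pi)) * mass (gaussMul f) ≤
      (Real.sqrt 2 / 4 * mass (gaussMul f)) * mass (gaussMul f) := by
    have h6 := mul_le_mul_of_nonneg_left hw hs2.le
    have h7 : Real.sqrt 2 * (4 * Real.pi * (Real.sqrt Real.pi / (8 * Real.sqrt 2)) *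
        (2 * ‖α‖ * mass (gaussMul f))) =
        (‖α‖ * (Real.pi * Real.sqrt Real.pi)) * mass (gaussMul f) := by
      field_simp
      ring
    rw [h7] at h6
    refine h6.trans (le_of_eq ?_)
    ring
  have h8 := le_of_mul_le_mul_right h5 hM0
  have h9 : ‖α‖ * Real.pi ≤ ‖α‖ * (Real.pi * Real.sqrt Real.pi) := by
    gcongr
    exact le_mul_of_one_le_right hpi.le hsp
  rw [le_div_iff₀ (by positivity)]
  have h10 : Real.sqrt 2 * Real.sqrt 2 = 2 := Real.mul_self_sqrt (by norm_num)
  calc ‖α‖ * (2 * Real.sqrt 2 * Real.pi) = 2 * Real.sqrt 2 * (‖α‖ * Real.pi) := by ring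
    _ ≤ 2 * Real.sqrt 2 * (Real.sqrt 2 / 4 * mass (gaussMul f)) := 
        mul_le_mul_of_nonneg_left (h9.trans h8) (by positivity)
    _ = _ := by linear_combination (mass (gaussMul f) / 2) * h10

/-! ### Symmetries of the system -/

/-- A unitary weighted composition `u ↦ c · (u ∘ φ)` that preserves `e^{-|z|²/2} 𝓞(ℂ)`. -/
structure FockTwist where
  /-- the unimodular weight -/
  weight : ℂ → ℂ
  /-- the measure preserving map -/
  map : ℂ → ℂ
  continuous_weight : Continuous weight
  norm_weight : ∀ z, ‖weight z‖ = 1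
  measurePreserving : MeasurePreserving map (volume : Measure ℂ) volume
  isGaussHolo : ∀ w, IsGaussHolo w → IsGaussHolo fun z => weight z * w (map z)

namespace FockTwist

variable (T : FockTwist)

lemma memLp {u : ℂ → ℂ} (hu : MemLp u 2 (volume : Measure ℂ)) :
    MemLp (fun z => T.weight z * u (T.map z)) 2 (volume : Measure ℂ) := by
  have h := hu.comp_measurePreserving T.measurePreserving
  refine h.mono (T.continuous_weight.aestronglyMeasurable.mul h.1) (ae_of_all _ fun z => ?_)
  simp [T.norm_weight]

lemma ae_comp {u w : ℂ → ℂ} (h : u =ᵐ[volume] w) :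
    (fun z => T.weight z * u (T.map z)) =ᵐ[volume] fun z => T.weight z * w (T.map z) := by
  filter_upwards [T.measurePreserving.quasiMeasurePreserving.ae_eq_comp h] with z hz
  simp only [Function.comp_apply] at hz
  rw [hz]

/-- The action of a twist on `L²(ℂ)`. -/
def toLp : L2C →ₗᵢ[ℂ] L2C where
  toFun u := (T.memLp (Lp.memLp u)).toLp
  map_add' u v := by
    refine Lp.ext ?_
    filter_upwards [(T.memLp (Lp.memLp (u + v))).coeFn_toLp, T.ae_comp (Lp.coeFn_add u v),
      Lp.coeFn_add (T.memLp (Lp.memLp u)).toLp (T.memLp (Lp.memLp v)).toLp,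
      (T.memLp (Lp.memLp u)).coeFn_toLp, (T.memLp (Lp.memLp v)).coeFn_toLp] with z h1 h2 h3 h4 h5
    rw [h1, h2, h3, Pi.add_apply, Pi.add_apply, h4, h5, mul_add]
  map_smul' c u := by
    refine Lp.ext ?_
    filter_upwards [(T.memLp (Lp.memLp (c • u))).coeFn_toLp, T.ae_comp (Lp.coeFn_smul c u),
      Lp.coeFn_smul c (T.memLp (Lp.memLp u)).toLp,
      (T.memLp (Lp.memLp u)).coeFn_toLp] with z h1 h2 h3 h4
    rw [h1, h2, RingHom.id_apply, h3, Pi.smul_apply, Pi.smul_apply, h4, smul_eq_mul, smul_eq_mul]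
    ring
  norm_map' u := by
    change ‖(T.memLp (Lp.memLp u)).toLp‖ = ‖u‖
    rw [Lp.norm_toLp, Lp.norm_def]
    congr 1
    rw [← eLpNorm_comp_measurePreserving (Lp.memLp u).1 T.measurePreserving]
    refine eLpNorm_congr_norm_ae (ae_of_all _ fun z => ?_)
    simp [T.norm_weight]

lemma coeFn_toLp (u : L2C) :
    (T.toLp u : ℂ → ℂ) =ᵐ[volume] fun z => T.weight z * (u : ℂ → ℂ) (T.map z) :=
  (T.memLp (Lp.memLp u)).coeFn_toLp

lemma toLp_mem_fock {u : L2C} (hu : u ∈ fock) : T.toLp u ∈ fock := by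
  obtain ⟨w, hw, h⟩ := hu
  exact ⟨_, T.isGaussHolo w hw, (T.coeFn_toLp u).trans (T.ae_comp h)⟩

/-- The action of a twist on `𝓔`. -/
def onFock : fock →L[ℂ] fock :=
  (T.toLp.toContinuousLinearMap.comp fock.subtypeL).codRestrict fock
    fun u => T.toLp_mem_fock u.2

lemma coe_onFock (u : fock) : ((T.onFock u : fock) : L2C) = T.toLp u := rfl

lemma toLp_toLp {S : FockTwist} (h1 : ∀ z, T.weight z * S.weight (T.map z) = 1)
    (h2 : ∀ z, S.map (T.map z) = z) (u : L2C) : T.toLp (S.toLp u) = u := by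
  refine Lp.ext ?_
  filter_upwards [T.coeFn_toLp (S.toLp u), T.ae_comp (S.coeFn_toLp u)] with z a1 a2
  rw [a1, a2, h2, ← mul_assoc, h1, one_mul]

/-- Every w ∈ 𝓔 is T(Sw) with Sw ∈ 𝓔, so by isometry T(u - Πu) is orthogonal to 𝓔. This is where a
twist inverse is needed. -/
lemma proj_toLp {S : FockTwist} (h1 : ∀ z, T.weight z * S.weight (T.map z) = 1)
    (h2 : ∀ z, S.map (T.map z) = z) (u : L2C) : proj (T.toLp u) = T.onFock (proj u) := by
  have h := Submodule.eq_starProjection_of_mem_of_inner_eq_zero (K := fock)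
    (u := T.toLp u) (v := T.toLp (proj u : L2C)) (T.toLp_mem_fock (proj u).2) fun w hw => by
      rw [← T.toLp_toLp h1 h2 w, ← map_sub, LinearIsometry.inner_map_map]
      exact fock.starProjection_inner_eq_zero u _ (S.toLp_mem_fock hw)
  exact Subtype.ext h

lemma cubic {u v : fock}
    (h : MemLp (fun z : ℂ => (‖(v : L2C) z‖ ^ 2 : ℂ) * (u : L2C) z) 2 volume) :
    ∃ h' : MemLp (fun z : ℂ => (‖(T.onFock v : L2C) z‖ ^ 2 : ℂ) * (T.onFock u : L2C) z) 2 volume,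
      h'.toLp = T.toLp h.toLp := by
  have e : (fun z : ℂ => T.weight z * ((‖(v : L2C) (T.map z)‖ ^ 2 : ℂ) * (u : L2C) (T.map z)))
      =ᵐ[volume] fun z : ℂ => (‖(T.onFock v : L2C) z‖ ^ 2 : ℂ) * (T.onFock u : L2C) z := by
    filter_upwards [T.coeFn_toLp u, T.coeFn_toLp v] with z a1 a2
    rw [coe_onFock, coe_onFock, a1, a2, norm_mul, T.norm_weight, one_mul]
    ring
  refine ⟨(T.memLp h).ae_eq e, Lp.ext ?_⟩
  filter_upwards [((T.memLp h).ae_eq e).coeFn_toLp, T.coeFn_toLp h.toLp, T.ae_comp h.coeFn_toLp, e]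
    with z a1 a2 a3 a4
  rw [a1, a2, a3, a4]

lemma contDiff_onFock {u : ℝ → fock} (hu : ContDiff ℝ ∞ u) :
    ContDiff ℝ ∞ fun t => T.onFock (u t) :=
  (T.onFock.restrictScalars ℝ).contDiff.comp hu

lemma deriv_onFock {u : ℝ → fock} (hu : ContDiff ℝ ∞ u) (t : ℝ) :
    deriv (fun t => T.onFock (u t)) t = T.onFock (deriv u t) :=
  ((T.onFock.restrictScalars ℝ).hasFDerivAt.comp_hasDerivAt t
    ((hu.differentiable (by simp)) t).hasDerivAt).deriv

lemma isSolution {S : FockTwist} (h1 : ∀ z, T.weight z * S.weight (T.map z) = 1)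
    (h2 : ∀ z, S.map (T.map z) = z) {σ : ℝ} {u v : ℝ → fock} (h : IsSolution σ u v) :
    IsSolution σ (fun t => T.onFock (u t)) (fun t => T.onFock (v t)) where
  smooth_fst := T.contDiff_onFock h.smooth_fst
  smooth_snd := T.contDiff_onFock h.smooth_snd
  eq_fst t := by
    obtain ⟨hm, he⟩ := h.eq_fst t
    obtain ⟨hm', he'⟩ := T.cubic hm
    exact ⟨hm', by
      rw [he', T.proj_toLp h1 h2, T.deriv_onFock h.smooth_fst, ← map_smul, he]⟩
  eq_snd t := by
    obtain ⟨hm, he⟩ := h.eq_snd t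
    obtain ⟨hm', he'⟩ := T.cubic hm
    exact ⟨hm', by
      rw [he', T.proj_toLp h1 h2, T.deriv_onFock h.smooth_snd, ← map_smul, he, map_smul]⟩

lemma isProgressiveWave {S : FockTwist} (h1 : ∀ z, T.weight z * S.weight (T.map z) = 1)
    (h2 : ∀ z, S.map (T.map z) = z) {σ lam mu lam' mu' : ℝ} {α α' : ℂ} {U V U' V' : ℂ → ℂ}
    (h : IsProgressiveWave σ lam mu α U V) (hU' : MemL21 U') (hV' : MemL21 V')
    (hU : ∀ t z, T.weight z * wave lam α U t (T.map z) = wave lam' α' U' t z)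
    (hV : ∀ t z, T.weight z * wave mu α V t (T.map z) = wave mu' α' V' t z) :
    IsProgressiveWave σ lam' mu' α' U' V' := by
  obtain ⟨u, v, hs, hw⟩ := h.solves
  refine ⟨hU', hV', _, _, T.isSolution h1 h2 hs, fun t => ⟨?_, ?_⟩⟩
  · exact (T.coeFn_toLp (u t)).trans ((T.ae_comp (hw t).1).trans (ae_of_all _ (hU t)))
  · exact (T.coeFn_toLp (v t)).trans ((T.ae_comp (hw t).2).trans (ae_of_all _ (hV t)))

end FockTwist

/-! ### Rotations and magnetic translations on the function spaces. -/

lemma isGaussHolo_iff {U : ℂ → ℂ} :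
    IsGaussHolo U ↔ ∃ f, Differentiable ℂ f ∧ U = gaussMul f :=
  ⟨fun ⟨f, hf, h⟩ => ⟨f, hf, funext h⟩, fun ⟨f, hf, h⟩ => ⟨f, hf, fun z => by rw [h]; rfl⟩⟩

lemma IsGaussHolo.rot {U : ℂ → ℂ} (h : IsGaussHolo U) (θ : ℝ) : IsGaussHolo (rot θ U) := by
  obtain ⟨f, hf, rfl⟩ := isGaussHolo_iff.1 h
  exact isGaussHolo_iff.2 ⟨_, differentiable_comp_rot θ hf, rot_gaussMul θ f⟩

lemma exp_neg_norm_sq_eq (w : ℂ) :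
    (Real.exp (-‖w‖ ^ 2 / 2) : ℂ) = exp (-(w * conj w) / 2) := by
  rw [mul_conj', ofReal_exp]
  push_cast
  rfl

lemma magTrans_gaussMul (β : ℂ) (f : ℂ → ℂ) :
    magTrans β (gaussMul f) =
      gaussMul fun z => exp (-(β * conj β) / 2 - z * conj β) * f (z + β) := by
  funext z
  unfold magTrans gaussMul
  have h : exp (-((z + β) * conj (z + β)) / 2) * exp ((1 / 2) * (conj z * β - z * conj β)) =
      exp (-(z * conj z) / 2) * exp (-(β * conj β) / 2 - z * conj β) := by
    simp only [← Complex.exp_add, map_add]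
    ring_nf
  rw [exp_neg_norm_sq_eq, exp_neg_norm_sq_eq, ← mul_assoc (exp (-(z * conj z) / 2)), ← h]
  ring

lemma IsGaussHolo.magTrans {U : ℂ → ℂ} (h : IsGaussHolo U) (β : ℂ) :
    IsGaussHolo (magTrans β U) := by
  obtain ⟨f, hf, rfl⟩ := isGaussHolo_iff.1 h
  refine isGaussHolo_iff.2 ⟨_, ?_, magTrans_gaussMul β f⟩
  have h1 : Differentiable ℂ fun z => f (z + β) := hf.comp (differentiable_id.add_const β)
  fun_prop

lemma MemL21.rot {U : ℂ → ℂ} (h : MemL21 U) (θ : ℝ) : MemL21 (rot θ U) := by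
  refine ⟨h.1.rot θ, ?_⟩
  have := h.2.comp_measurePreserving (measurePreserving_rot θ)
  refine this.ae_eq (ae_of_all _ fun z => ?_)
  simp only [Function.comp_apply, norm_mul, norm_exp_I_mul_ofReal, one_mul]
  rfl

lemma norm_magTrans_phase (β z : ℂ) :
    ‖exp ((1 / 2) * (conj z * β - z * conj β))‖ = 1 := by
  rw [norm_exp, Real.exp_eq_one_iff]
  simp

lemma IsGaussHolo.continuous {U : ℂ → ℂ} (h : IsGaussHolo U) : Continuous U := by
  obtain ⟨f, hf, rfl⟩ := isGaussHolo_iff.1 h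
  exact continuous_gaussMul hf

lemma MemL21.magTrans {U : ℂ → ℂ} (h : MemL21 U) (β : ℂ) : MemL21 (magTrans β U) := by
  refine ⟨h.1.magTrans β, ?_⟩
  -- The constant comes from 1 + |z|² ≤ 2(1 + |β|²)(1 + |z + β|²).
  have h1 := (h.2.comp_measurePreserving
    (measurePreserving_add_right (volume : Measure ℂ) β)).const_mul
    (Real.sqrt (2 * (1 + ‖β‖ ^ 2)) : ℂ)
  have hc := (h.1.magTrans β).continuous
  refine h1.mono (by fun_prop) (ae_of_all _ fun z => ?_)
  simp only [Function.comp_apply, norm_mul, norm_real, Real.norm_of_nonneg (Real.sqrt_nonneg _)]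
  unfold LLL.magTrans
  rw [norm_mul, norm_magTrans_phase, mul_one, ← mul_assoc, ← Real.sqrt_mul (by positivity)]
  refine mul_le_mul_of_nonneg_right (Real.sqrt_le_sqrt ?_) (norm_nonneg _)
  have h2 : ‖z‖ ≤ ‖z + β‖ + ‖β‖ := by
    simpa using norm_sub_le (z + β) β
  have h3 : ‖z‖ ^ 2 ≤ (‖z + β‖ + ‖β‖) ^ 2 := pow_le_pow_left₀ (norm_nonneg _) h2 2
  nlinarith [sq_nonneg (‖z + β‖ - ‖β‖), sq_nonneg (‖z + β‖ * ‖β‖)]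

/-- Rotations as twists. -/
def rotTwist (θ : ℝ) : FockTwist where
  weight _ := 1
  map z := exp (I * θ) * z
  continuous_weight := continuous_const
  norm_weight _ := norm_one
  measurePreserving := measurePreserving_rot θ
  isGaussHolo w hw := by
    simp only [one_mul]
    exact hw.rot θ

/-- Magnetic translations as twists. -/
def magTwist (β : ℂ) : FockTwist where
  weight z := exp ((1 / 2) * (conj z * β - z * conj β))
  map z := z + β
  continuous_weight := by fun_prop
  norm_weight := norm_magTrans_phase β
  measurePreserving := measurePreserving_add_right volume β
  isGaussHolo w hw := by
    simp_rw [mul_comm (exp _)]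
    exact hw.magTrans β

/-! ### Symmetries acting on progressive waves. -/

section Symmetry

variable {lam mu : ℝ} {α : ℂ} {U V : ℂ → ℂ}

lemma IsProgressiveWave.rot {σ : ℝ} (h : IsProgressiveWave σ lam mu α U V) (θ : ℝ) :
    IsProgressiveWave σ lam mu (α * exp (-I * θ)) (rot θ U) (rot θ V) := by
  have key : ∀ (l : ℝ) (W : ℂ → ℂ) (t : ℝ) (z : ℂ), 1 * wave l α W t (exp (I * θ) * z) =
      wave l (α * exp (-I * θ)) (LLL.rot θ W) t z := by
    intro l W t z
    have he : exp (I * θ) * exp (-I * θ) = 1 := by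
      rw [← Complex.exp_add]
      simp
    have hc1 : conj (exp (I * θ)) = exp (-I * θ) := by
      rw [← exp_conj]
      simp
    have hc2 : conj (exp (-I * θ)) = exp (I * θ) := by
      rw [← exp_conj]
      simp
    unfold wave LLL.rot
    rw [one_mul, map_mul, map_mul, hc1, hc2]
    congr 2
    · congr 2
      linear_combination (-α * t) * he
    · ring
  refine (rotTwist θ).isProgressiveWave (S := rotTwist (-θ)) (fun z => one_mul 1) (fun z => ?_) h
    (h.mem_fst.rot θ) (h.mem_snd.rot θ) (fun t z => key lam U t z) (fun t z => key mu V t z)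
  change exp (I * (-θ : ℝ)) * (exp (I * θ) * z) = z
  rw [← mul_assoc, exp_I_mul_exp_neg, one_mul]

/-- Magnetic translations by β and αt commute only up to a unimodular constant, whose phase is
linear in t; it is absorbed in both frequencies. -/
lemma IsProgressiveWave.magTrans {σ : ℝ} (h : IsProgressiveWave σ lam mu α U V) (β : ℂ) :
    IsProgressiveWave σ (lam + 2 * (β * conj α).im) (mu + 2 * (β * conj α).im) α
      (magTrans β U) (magTrans β V) := by
  have key : ∀ (l : ℝ) (W : ℂ → ℂ) (t : ℝ) (z : ℂ),
      exp ((1 / 2) * (conj z * β - z * conj β)) * wave l α W t (z + β) =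
      wave (l + 2 * (β * conj α).im) α (LLL.magTrans β W) t z := by
    intro l W t z
    have hy : 2 * I * ((β * conj α).im : ℂ) = β * conj α - conj β * α := by
      have h1 := sub_conj (β * conj α)
      rw [map_mul, conj_conj] at h1
      rw [h1]
      push_cast
      ring
    unfold wave LLL.magTrans
    have h2 : exp ((1 / 2) * (conj z * β - z * conj β)) * (exp (-I * l * t) *
        exp ((1 / 2) * (conj (z + β) * α - (z + β) * conj α) * t)) =
        exp (-I * ((l + 2 * (β * conj α).im : ℝ) : ℂ) * t) *
        (exp ((1 / 2) * (conj (z + α * t) * β - (z + α * t) * conj β)) *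
          exp ((1 / 2) * (conj z * α - z * conj α) * t)) := by
      simp only [← Complex.exp_add]
      congr 1
      simp only [map_add, map_mul, conj_ofReal]
      push_cast
      linear_combination (t : ℂ) * hy
    have h3 : z + β + α * t = z + α * t + β := by ring
    rw [h3]
    linear_combination W (z + α * t + β) * h2
  refine (magTwist β).isProgressiveWave (S := magTwist (-β)) (fun z => ?_)
    (fun z => add_neg_cancel_right z β) h (h.mem_fst.magTrans β) (h.mem_snd.magTrans β)
    (fun t z => key lam U t z) (fun t z => key mu V t z)
  change exp ((1 / 2) * (conj z * β - z * conj β)) *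
    exp ((1 / 2) * (conj (z + β) * (-β) - (z + β) * conj (-β))) = 1
  rw [← Complex.exp_add, Complex.exp_eq_one_iff]
  refine ⟨0, ?_⟩
  simp only [map_add, map_neg]
  push_cast
  ring

lemma MemL21.const_mul (h : MemL21 U) (c : ℂ) : MemL21 fun z => c * U z := by
  obtain ⟨f, hf, he⟩ := h.1
  refine ⟨⟨fun z => c * f z, hf.const_mul c, fun z => ?_⟩, ?_⟩
  · simp only [he]
    ring
  · refine (h.2.const_mul c).ae_eq (ae_of_all _ fun z => ?_)
    ring

/-- Time reversal changes the sign of both equations and exchanging the components changes it back;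
this needs the sign -1 of the system. -/
lemma IsProgressiveWave.swap (h : IsProgressiveWave (-1) lam mu α U V) :
    IsProgressiveWave (-1) (-mu) (-lam) (-α) V U := by
  obtain ⟨u, v, hs, hw⟩ := h.solves
  have key : ∀ (l : ℝ) (W : ℂ → ℂ) (t : ℝ), wave l α W (-t) = wave (-l) (-α) W t := by
    intro l W t
    funext z
    unfold wave
    simp only [map_neg]
    push_cast
    ring_nf
  refine ⟨h.mem_snd, h.mem_fst, fun t => v (-t), fun t => u (-t), ⟨?_, ?_, fun t => ?_, fun t => ?_⟩,
    fun t => ⟨?_, ?_⟩⟩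
  · exact hs.smooth_snd.comp contDiff_neg
  · exact hs.smooth_fst.comp contDiff_neg
  · obtain ⟨hm, he⟩ := hs.eq_snd (-t)
    refine ⟨hm, ?_⟩
    rw [deriv_comp_neg, smul_neg, he]
    simp
  · obtain ⟨hm, he⟩ := hs.eq_fst (-t)
    refine ⟨hm, ?_⟩
    rw [deriv_comp_neg, smul_neg, he]
    simp
  · rw [← key]
    exact (hw (-t)).2
  · rw [← key]
    exact (hw (-t)).1

lemma cubic_smul {a b : ℂ} {K : ℝ} (hb : ‖b‖ = K) {u v : fock}
    (h : MemLp (fun z : ℂ => (‖(v : L2C) z‖ ^ 2 : ℂ) * (u : L2C) z) 2 volume) :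
    ∃ h' : MemLp (fun z : ℂ => (‖((b • v : fock) : L2C) z‖ ^ 2 : ℂ) *
      ((a • u : fock) : L2C) z) 2 volume, h'.toLp = (a * (K : ℂ) ^ 2) • h.toLp := by
  have e : (fun z : ℂ => (a * (K : ℂ) ^ 2) * ((‖(v : L2C) z‖ ^ 2 : ℂ) * (u : L2C) z))
      =ᵐ[volume] fun z : ℂ => (‖((b • v : fock) : L2C) z‖ ^ 2 : ℂ) *
      ((a • u : fock) : L2C) z := by
    filter_upwards [Lp.coeFn_smul a (u : L2C), Lp.coeFn_smul b (v : L2C)] with z a1 a2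
    rw [Submodule.coe_smul, Submodule.coe_smul, a1, a2, Pi.smul_apply, Pi.smul_apply, norm_smul,
      hb, smul_eq_mul]
    push_cast
    ring
  refine ⟨(h.const_mul _).ae_eq e, Lp.ext ?_⟩
  filter_upwards [((h.const_mul _).ae_eq e).coeFn_toLp, Lp.coeFn_smul (a * (K : ℂ) ^ 2) h.toLp,
    h.coeFn_toLp, e] with z a1 a2 a3 a4
  rw [a1, a2, Pi.smul_apply, a3, ← a4, smul_eq_mul]

/-- The nonlinearity is cubic and phase invariant, so multiplying by constants of modulus K amounts
to running time at speed K². -/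
lemma IsProgressiveWave.scale {σ : ℝ} (h : IsProgressiveWave σ lam mu α U V) {K : ℝ} {a b : ℂ}
    (ha : ‖a‖ = K) (hb : ‖b‖ = K) :
    IsProgressiveWave σ (K ^ 2 * lam) (K ^ 2 * mu) ((K : ℂ) ^ 2 * α)
      (fun z => a * U z) (fun z => b * V z) := by
  obtain ⟨u, v, hs, hw⟩ := h.solves
  have key : ∀ (c : ℂ) (l : ℝ) (W : ℂ → ℂ) (t : ℝ) (z : ℂ), c * wave l α W (K ^ 2 * t) z =
      wave (K ^ 2 * l) ((K : ℂ) ^ 2 * α) (fun z => c * W z) t z := by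
    intro c l W t z
    unfold wave
    simp only [map_mul, map_pow, conj_ofReal]
    push_cast
    ring_nf
  have hd : ∀ (c : ℂ) {w : ℝ → fock} (_ : ContDiff ℝ ∞ w) (t : ℝ),
      deriv (fun t => c • w (K ^ 2 * t)) t = (c * (K : ℂ) ^ 2) • deriv w (K ^ 2 * t) := by
    intro c w hwd t
    have h1 : HasDerivAt (fun t : ℝ => K ^ 2 * t) (K ^ 2) t := by
      simpa using (hasDerivAt_id t).const_mul (K ^ 2)
    have h2 := (((hwd.differentiable (by simp)) (K ^ 2 * t)).hasDerivAt.scomp t h1).const_smul c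
    refine h2.deriv.trans ?_
    rw [mul_smul]
    congr 1
    rw [← ofReal_pow]
    rfl
  have hsm : ∀ (c : ℂ) {w : ℝ → fock} (_ : ContDiff ℝ ∞ w),
      ContDiff ℝ ∞ fun t => c • w (K ^ 2 * t) := fun c w hwd =>
    (hwd.comp (contDiff_const.mul contDiff_id)).const_smul c
  have hae : ∀ (c : ℂ) (w : fock) {F : ℂ → ℂ}, ((w : L2C) : ℂ → ℂ) =ᵐ[volume] F →
      (((c • w : fock) : L2C) : ℂ → ℂ) =ᵐ[volume] fun z => c * F z := by
    intro c w F hF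
    filter_upwards [Lp.coeFn_smul c (w : L2C), hF] with z a1 a2
    rw [Submodule.coe_smul, a1, Pi.smul_apply, a2, smul_eq_mul]
  refine ⟨h.mem_fst.const_mul a, h.mem_snd.const_mul b, fun t => a • u (K ^ 2 * t),
    fun t => b • v (K ^ 2 * t), ⟨hsm a hs.smooth_fst, hsm b hs.smooth_snd, fun t => ?_,
    fun t => ?_⟩, fun t => ⟨?_, ?_⟩⟩
  · obtain ⟨hm, he⟩ := hs.eq_fst (K ^ 2 * t)
    obtain ⟨hm', he'⟩ := cubic_smul (a := a) hb hm
    refine ⟨hm', ?_⟩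
    rw [he', hd a hs.smooth_fst, smul_comm, he, map_smul]
  · obtain ⟨hm, he⟩ := hs.eq_snd (K ^ 2 * t)
    obtain ⟨hm', he'⟩ := cubic_smul (a := b) ha hm
    refine ⟨hm', ?_⟩
    rw [he', hd b hs.smooth_snd, smul_comm, he, map_smul, smul_comm]
  · exact (hae a _ (hw (K ^ 2 * t)).1).trans (ae_of_all _ (key a lam U t))
  · exact (hae b _ (hw (K ^ 2 * t)).2).trans (ae_of_all _ (key b mu V t))

end Symmetry

/-! ### From progressive waves to profiles and their momenta. -/

lemma IsProgressiveWave.exists_isProfile {lam mu : ℝ} {α : ℂ} {U V : ℂ → ℂ}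
    (h : IsProgressiveWave (-1) lam mu α U V) (hα : α ≠ 0) :
    ∃ f g, U = gaussMul f ∧ V = gaussMul g ∧ IsProfile 1 lam α f (gaussMul g) ∧
      IsProfile (-1) mu α g (gaussMul f) := by
  obtain ⟨f, hf, rfl⟩ := isGaussHolo_iff.1 h.mem_fst.1
  obtain ⟨g, hg, rfl⟩ := isGaussHolo_iff.1 h.mem_snd.1
  obtain ⟨u, v, hs, hw⟩ := h.solves
  refine ⟨f, g, rfl, rfl, ?_, ?_⟩
  · refine isProfile_of_solves hα hf h.mem_fst (hs.smooth_fst.differentiable (by simp) 0)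
      (fun t => (hw t).1) (hw 0).2 ?_
    simpa using hs.eq_fst 0
  · exact isProfile_of_solves hα hg h.mem_snd (hs.smooth_snd.differentiable (by simp) 0)
      (fun t => (hw t).2) (hw 0).1 (hs.eq_snd 0)

lemma conj_mul_Qminus {lam mu : ℝ} {α : ℂ} {f g : ℂ → ℂ}
    (hU : IsProfile 1 lam α f (gaussMul g)) (hV : IsProfile (-1) mu α g (gaussMul f)) :
    (conj α * Qminus (gaussMul f) (gaussMul g)).re =
        momRe α (gaussMul f) - momRe α (gaussMul g) ∧
      (conj α * Qminus (gaussMul f) (gaussMul g)).im =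
        momIm α (gaussMul f) - momIm α (gaussMul g) := by
  have i0 : ∀ {s l : ℝ} {p q : ℂ → ℂ}, IsProfile s l α p (gaussMul q) →
      Integrable fun z => (conj α * z) * ((‖gaussMul p z‖ ^ 2 : ℝ) : ℂ) := by
    intro s l p q h
    refine ((integrable_mul_conj h.memLp_mul h.memLp).const_mul (conj α)).congr
      (ae_of_all _ fun z => ?_)
    simp only [← gaussMul_mul_conj_self]
    ring
  have iU := i0 hU
  have iV := i0 hV
  have e : conj α * Qminus (gaussMul f) (gaussMul g) =
      (∫ z, (conj α * z) * ((‖gaussMul f z‖ ^ 2 : ℝ) : ℂ)) -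
        ∫ z, (conj α * z) * ((‖gaussMul g z‖ ^ 2 : ℝ) : ℂ) := by
    unfold Qminus
    rw [← integral_const_mul, ← integral_sub iU iV]
    congr 1
    funext z
    push_cast
    ring
  have r := fun {F : ℂ → ℂ} (hF : Integrable F) => reCLM.integral_comp_comm hF
  have m := fun {F : ℂ → ℂ} (hF : Integrable F) => imCLM.integral_comp_comm hF
  simp only [reCLM_apply] at r
  simp only [imCLM_apply] at m
  rw [e, sub_re, sub_im, ← r iU, ← r iV, ← m iU, ← m iV]
  simp only [re_mul_ofReal, im_mul_ofReal]
  exact ⟨rfl, rfl⟩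

end LLL

end

theorem proposition1p8 (U V : ℂ → ℂ) (lam mu : ℝ) (α : ℂ)
    (hw : LLL.IsProgressiveWave (-1) lam mu α U V)
    (hne : ¬ (U = 0 ∧ V = 0)) (hα : α ≠ 0) :
    -- (i)
    LLL.mass U = LLL.mass V ∧
    -- (ii)
    (conj α * LLL.Qminus U V).re = 0 ∧
    -- (iii)
    (conj α * LLL.Qminus U V).im ≠ 0 ∧
    -- (iv) scaling and phases, space rotation, magnetic translation, swap
    ((∀ K θ₁ θ₂ : ℝ, 0 ≤ K →
        LLL.IsProgressiveWave (-1) (K ^ 2 * lam) (K ^ 2 * mu) ((K : ℂ) ^ 2 * α)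
          (fun z => (K : ℂ) * exp (I * θ₁) * U z) (fun z => (K : ℂ) * exp (I * θ₂) * V z)) ∧
      (∀ θ : ℝ,
        LLL.IsProgressiveWave (-1) lam mu (α * exp (-I * θ)) (LLL.rot θ U) (LLL.rot θ V)) ∧
      (∀ β : ℂ,
        LLL.IsProgressiveWave (-1) (lam + 2 * (β * conj α).im) (mu + 2 * (β * conj α).im) α
          (LLL.magTrans β U) (LLL.magTrans β V)) ∧
      LLL.IsProgressiveWave (-1) (-mu) (-lam) (-α) V U) ∧
    -- (v)
    α = LLL.speed U V ∧
    -- (vi)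
    ‖α‖ ≤ LLL.mass U / (2 * Real.sqrt 2 * Real.pi) ∧
    -- (vii)
    ((lam - mu : ℝ) : ℂ) * (LLL.mass U : ℂ) - 2 * I * conj α * LLL.Qminus U V =
      2 * (LLL.ham U V : ℂ) := by
  have hnorm : ∀ K θ : ℝ, 0 ≤ K → ‖(K : ℂ) * exp (I * θ)‖ = K := fun K θ hK => by
    rw [norm_mul, LLL.norm_exp_I_mul_ofReal, mul_one, norm_real, Real.norm_of_nonneg hK]
  have hiv := And.intro (fun (K θ₁ θ₂ : ℝ) (hK : 0 ≤ K) =>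
    hw.scale (hnorm K θ₁ hK) (hnorm K θ₂ hK)) (And.intro hw.rot (And.intro hw.magTrans hw.swap))
  obtain ⟨f, g, rfl, rfl, hU, hV⟩ := hw.exists_isProfile hα
  have hM := LLL.mass_eq_of_isProfile hα hU hV
  -- By equality of masses, zero mass for one component would make both vanish.
  have hm : LLL.mass (LLL.gaussMul f) ≠ 0 := fun h0 => hne
    ⟨LLL.eq_zero_of_mass_eq_zero hU.diff hU.integrable_sq h0,
      LLL.eq_zero_of_mass_eq_zero hV.diff hV.integrable_sq (hM ▸ h0)⟩
  obtain ⟨hre, him⟩ := LLL.conj_mul_Qminus hU hV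
  rw [LLL.momRe_eq_of_isProfile hU hV, sub_self] at hre
  refine ⟨hM, hre, ?_, hiv, ?_, LLL.norm_speed_le_of_isProfile hα hU hV hm, ?_⟩
  · rw [him]
    exact sub_ne_zero.2 (LLL.momIm_ne_of_isProfile hα hU hV hm)
  · have h1 := hU.speed_identity hV.diff
    have hm' : (LLL.mass (LLL.gaussMul f) : ℂ) ≠ 0 := ofReal_ne_zero.2 hm
    unfold LLL.speed
    simp_rw [mul_conj'] at h1
    rw [ofReal_one, one_mul] at h1
    rw [h1]
    field_simp
    linear_combination I_sq
  · have e1 := hU.energy hV.diff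
    have e2 := hV.energy hU.diff
    have hh : LLL.ham (LLL.gaussMul g) (LLL.gaussMul f) =
        LLL.ham (LLL.gaussMul f) (LLL.gaussMul g) := by
      unfold LLL.ham
      simp_rw [mul_comm]
    rw [hh, ← hM] at e2
    -- By (ii) this number is purely imaginary, so -2iᾱQ₋ is real: twice the difference of the
    -- Im-moments, as in the difference of the energy identities.
    have hQ : conj α * LLL.Qminus (LLL.gaussMul f) (LLL.gaussMul g) =
        ((LLL.momIm α (LLL.gaussMul f) - LLL.momIm α (LLL.gaussMul g) : ℝ) : ℂ) * I := by
      apply Complex.ext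
      · simpa using hre
      · simpa using him
    have e3 : (lam - mu) * LLL.mass (LLL.gaussMul f) +
        2 * (LLL.momIm α (LLL.gaussMul f) - LLL.momIm α (LLL.gaussMul g)) =
        2 * LLL.ham (LLL.gaussMul f) (LLL.gaussMul g) := by
      linarith
    have e4 : ((lam - mu : ℝ) : ℂ) * (LLL.mass (LLL.gaussMul f) : ℂ) +
        2 * ((LLL.momIm α (LLL.gaussMul f) - LLL.momIm α (LLL.gaussMul g) : ℝ) : ℂ) =
        2 * (LLL.ham (LLL.gaussMul f) (LLL.gaussMul g) : ℂ) := by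
      exact_mod_cast e3
    rw [mul_assoc, hQ]
    linear_combination e4 -
      2 * ((LLL.momIm α (LLL.gaussMul f) - LLL.momIm α (LLL.gaussMul g) : ℝ) : ℂ) * I_sq
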